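/- Let $\mathcal I=\{1,\dots,N\}$ be the set of nodes of a connected finite directed graph, and let $\mathcal V(i)\subset\mathcal I\setminus\{i\}$ be the set of nodes $j$ such that there is an edge from $i$ to $j$. For $i\in\mathcal I$ let $L(i,\cdot):\mathbb R_+^{\mathcal V(i)}\to\mathbb R\cup\{+\infty\}$ be such that (A1) for every $i$ there is $(\lambda_{ij})_{j\in\mathcal V(i)}$ with all $\lambda_{ij}>0$ and $L(i,(\lambda_{ij})_j)<+\infty$; (A2) every $L(i,\cdot)$ is lower semi-continuous; (A3) there is $\underline C\in\mathbb R$ with $L(i,\cdot)\ge\underline C$ for all $i$; (A4) for every $i$, $L(i,\lambda)/\|\lambda\|_\infty\to+\infty$ as $\|\lambda\|_\infty\to+\infty$. Let $g:\mathcal I\to\mathbb R$, let $r>0$, and let $H(i,p)=\sup_{\lambda\in\mathbb R_+^{\mathcal V(i)}}\big(\sum_{j\in\mathcal V(i)}\lambda_jp_j-L(i,\lambda)\big)$ for $p\in\mathbb R^{\mathcal V(i)}$. For $0\le t\le T$ let $\mathcal A_t^T$ (respectively $\mathcal A_t^\infty$) be the set of deterministic non-negative families $(\lambda_s(i,j))$,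 indexed by $i\in\mathcal I$, $j\in\mathcal V(i)$ and $s\in[t,T]$ (respectively $s\in[t,\infty)$), such that every $s\mapsto\lambda_s(i,j)$ is in $L^1(t,T)$ (respectively in $L^1_{\rm loc}([t,\infty))$). For such a $\lambda$ let $X^{t,i,\lambda}$ be the continuous-time Markov chain with right-continuous paths having left limits, started from $i$ at time $t$, with transition rate $\lambda_s(i,j)$ from $i$ to $j\in\mathcal V(i)$ at time $s$. Define, with values in $[-\infty,+\infty]$, $$u_i^{T,r}(t)=\sup_{\lambda\in\mathcal A_t^T}\mathbb E\Big[-\int_t^Te^{-r(s-t)}L\big(X_s^{t,i,\lambda},(\lambda_s(X_s^{t,i,\lambda},j))_{j\in\mathcal V(X_s^{t,i,\lambda})}\big)ds+e^{-r(T-t)}g\big(X_T^{t,i,\lambda}\big)\Big],$$ $$u_i^r=\sup_{\lambda\in\mathcal A_0^\infty}\mathbb E\Big[-\int_0^\infty e^{-rs}L\big(X_s^{0,i,\lambda},(\lambda_s(X_s^{0,i,\lambda},j))_{j\in\mathcal V(X_s^{0,i,\lambda})}\big)ds\Big].$$ Then $u_i^r\in\mathbb R$ for every $i\in\mathcal I$,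 and $$\lim_{T\to+\infty}u_i^{T,r}(t)=u_i^r\qquad\text{for all }(i,t)\in\mathcal I\times\mathbb R_+ .$$ Furthermore, $(u_i^r)_{i\in\mathcal I}$ satisfies the stationary Bellman equation $$-r\,u_i^r+H\big(i,(u_j^r-u_i^r)_{j\in\mathcal V(i)}\big)=0\qquad\text{for all }i\in\mathcal I .$$ -/

import Mathlib

open MeasureTheory Filter Topology
open scoped NNReal ENNReal

noncomputable section

namespace GraphControl

variable {N : ℕ}

/-- Non-negative intensities on the edges of the directed graph on `Fin N` in which `V i` is the
set of nodes `j` such that there is an edge from `i` to `j`. -/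
abbrev Intensities (V : Fin N → Finset (Fin N)) : Type := (i : Fin N) → V i → ℝ≥0

/-- The graph with neighborhoods `V` is connected: any two nodes are joined by a path of edges,
the orientation of the edges being disregarded. -/
def Connected (V : Fin N → Finset (Fin N)) : Prop :=
  ∀ i j : Fin N, Relation.ReflTransGen (fun a b => b ∈ V a ∨ a ∈ V b) i j

/-- The assumptions on the running costs `L i : ℝ₊^{V i} → ℝ ∪ {+∞}`. The value `⊥ = -∞` is
excluded by the bound from below. -/
structure CostAssumptions (V : Fin N → Finset (Fin N))
    (L : (i : Fin N) → (V i → ℝ≥0) → EReal) : Prop where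
  nondegenerate : ∀ i, ∃ l : V i → ℝ≥0, (∀ j, 0 < l j) ∧ L i l < ⊤
  lowerSemicontinuous : ∀ i, LowerSemicontinuous (L i)
  bounded_below : ∃ C : ℝ, ∀ i l, (C : EReal) ≤ L i l
  superlinear : ∀ i, Tendsto
    (fun l : V i → ℝ≥0 => L i l / ((‖fun j => (l j : ℝ)‖ : ℝ) : EReal))
    (comap (fun l : V i → ℝ≥0 => ‖fun j => (l j : ℝ)‖) atTop) (𝓝 ⊤)

/-- The Hamiltonian `H(i, p) = sup_l (∑_j l_j p_j - L(i, l))`. -/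
def hamiltonian {V : Fin N → Finset (Fin N)} (L : (i : Fin N) → (V i → ℝ≥0) → EReal)
    (i : Fin N) (p : V i → ℝ) : EReal :=
  ⨆ l : V i → ℝ≥0, (((∑ j, (l j : ℝ) * p j : ℝ) : EReal) - L i l)

/-- The set `𝒜_t^T` of admissible controls on `[t, T]`. -/
def admissible (V : Fin N → Finset (Fin N)) (t T : ℝ) : Set (ℝ → Intensities V) :=
  {l | ∀ i (j : V i), IntegrableOn (fun s => (l s i j : ℝ)) (Set.Icc t T)}

/-- The set `𝒜_t^∞` of admissible controls on `[t, ∞)`. -/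
def admissibleInf (V : Fin N → Finset (Fin N)) (t : ℝ) : Set (ℝ → Intensities V) :=
  {l | ∀ i (j : V i), LocallyIntegrableOn (fun s => (l s i j : ℝ)) (Set.Ici t)}

/-- The matrix of transition rates (off-diagonal entries are the intensities, rows sum to `0`). -/
def generator {V : Fin N → Finset (Fin N)} (l : Intensities V) : Matrix (Fin N) (Fin N) ℝ :=
  fun i j => (if h : j ∈ V i then (l i ⟨j, h⟩ : ℝ) else 0) -
    (if i = j then ∑ k : V i, (l i k : ℝ) else 0)

/-- `p s u` (`s ≤ u` in the time interval `S`) is the transition function with rates `l`: the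
continuous solution of the Kolmogorov forward equation
`p s u = 1 + ∫_s^u p s v * generator (l v) dv`. -/
def IsTransitionFunction {V : Fin N → Finset (Fin N)} (S : Set ℝ) (l : ℝ → Intensities V)
    (p : ℝ → ℝ → Matrix (Fin N) (Fin N) ℝ) : Prop :=
  ∀ s ∈ S, ∀ i j,
    ContinuousOn (fun u => p s u i j) (S ∩ Set.Ici s) ∧
    ∀ u ∈ S, s ≤ u →
      p s u i j = (1 : Matrix (Fin N) (Fin N) ℝ) i j +
        ∫ v in s..u, (p s v * generator (l v)) i j

/-- `X` is a continuous-time Markov chain on the time interval `S`, started from `i` at time `t`,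
with transition rates `l`. -/
structure IsMarkovChain {V : Fin N → Finset (Fin N)} {Ω : Type} [MeasurableSpace Ω]
    (P : Measure Ω) (S : Set ℝ) (t : ℝ) (i : Fin N) (l : ℝ → Intensities V)
    (X : ℝ → Ω → Fin N) : Prop where
  measurable : ∀ s ∈ S, Measurable (X s)
  right_continuous : ∀ ω, ∀ s ∈ S, ContinuousWithinAt (fun u => X u ω) (S ∩ Set.Ici s) s
  left_limits : ∀ ω, ∀ s ∈ S, ∃ j, Tendsto (fun u => X u ω) (𝓝[S ∩ Set.Iio s] s) (𝓝 j)
  initial : ∀ᵐ ω ∂P, X t ω = i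
  markov : ∃ p, IsTransitionFunction S l p ∧
    ∀ (n : ℕ) (τ : Fin (n + 1) → ℝ) (x : Fin (n + 1) → Fin N), Monotone τ → (∀ k, τ k ∈ S) →
      ∀ u ∈ S, τ (Fin.last n) ≤ u → ∀ j : Fin N,
        P.real {ω | (∀ k, X (τ k) ω = x k) ∧ X u ω = j} =
          P.real {ω | ∀ k, X (τ k) ω = x k} * p (τ (Fin.last n)) u (x (Fin.last n)) j

/-- The Lebesgue integral of an extended-real function, as the integral of its positive part minus
that of its negative part. -/
def eintegral {α : Type} [MeasurableSpace α] (μ : Measure α) (f : α → EReal) : EReal :=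
  ((∫⁻ a, (f a).toENNReal ∂μ : ℝ≥0∞) : EReal) - ((∫⁻ a, (-f a).toENNReal ∂μ : ℝ≥0∞) : EReal)

/-- The cost `∫_S e^{-r(s-t)} L(X_s, l_s(X_s, ·)) ds` along the path `X`. -/
def discountedCost {V : Fin N → Finset (Fin N)} (L : (i : Fin N) → (V i → ℝ≥0) → EReal)
    (r t : ℝ) (S : Set ℝ) (l : ℝ → Intensities V) (X : ℝ → Fin N) : EReal :=
  eintegral (volume.restrict S)
    (fun s => ((Real.exp (-r * (s - t)) : ℝ) : EReal) * L (X s) (l s (X s)))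

/-- The value function `u_i^{T,r}(t)`: the supremum, over the admissible controls, of the expected
discounted payoff along the controlled chain (in any of its realizations; the expected payoff
depends only on the law of the chain). -/
def value {V : Fin N → Finset (Fin N)} (L : (i : Fin N) → (V i → ℝ≥0) → EReal)
    (g : Fin N → ℝ) (r T : ℝ) (i : Fin N) (t : ℝ) : EReal :=
  sSup {y | ∃ l ∈ admissible V t T,
    ∃ (Ω : Type) (_ : MeasurableSpace Ω) (P : Measure Ω) (_ : IsProbabilityMeasure P)
      (X : ℝ → Ω → Fin N), IsMarkovChain P (Set.Icc t T) t i l X ∧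
      y = eintegral P (fun ω =>
        -discountedCost L r t (Set.Icc t T) l (fun s => X s ω) +
          ((Real.exp (-r * (T - t)) * g (X T ω) : ℝ) : EReal))}

/-- The value of the infinite-horizon problem started from node `i` at time `0`. -/
def valueInf {V : Fin N → Finset (Fin N)} (L : (i : Fin N) → (V i → ℝ≥0) → EReal)
    (r : ℝ) (i : Fin N) : EReal :=
  sSup {y | ∃ l ∈ admissibleInf V 0,
    ∃ (Ω : Type) (_ : MeasurableSpace Ω) (P : Measure Ω) (_ : IsProbabilityMeasure P)
      (X : ℝ → Ω → Fin N), IsMarkovChain P (Set.Ici 0) 0 i l X ∧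
      y = eintegral P (fun ω => -discountedCost L r 0 (Set.Ici 0) l (fun s => X s ω))}

end GraphControl

end

/-! The Bellman equation is solved first; its solution `u` is then identified with the values by
verification.

For a control `l` of finite cost, the supersolution inequality at `i` reads `(∑ l_j v_j - L(i,l)) /
(r + ∑ l_j) ≤ v_i`, and its left side is monotone in `v`. Hence the pointwise infimum `u` of all
supersolutions is again one. At each node some `l` attains equality for `u`: otherwise lower
semicontinuity and superlinear growth give a uniform gap (`exists_gap`), and lowering `u` at that
node alone contradicts minimality (`exists_bellman_solution`). The maximizers form a feedback `m`,
constant in time.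

The supersolution inequality bounds the running cost below by `bellmanRate`, with equality along
`m`. By Dynkin's formula (`IsMarkovChain.dynkin`) the payoff on `[t, T]` of any control is at most
`u_i + e^{-r(T-t)} E[(g-u)(X_T)]`, with equality for `m`. The last term vanishes as `T → ∞`. On the
infinite horizon the cost beyond `T` is compared with a constant `C`, which acts as a terminal
payoff `-C/r`.

The lower bounds need a chain with the rates `m` (`exists_isMarkovChain_const`), built by
uniformization: at the events of a Poisson process of rate `Λ`, an independent random map is applied
to the state. First-event decompositions give renewal equations, whose solutions are unique
(`eq_zero_of_renewal`). Uniqueness yields both the Markov property and the identification of the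
transition function with `exp (τ Q)`. -/

noncomputable section

namespace GraphControl

variable {N : ℕ}

/-! ### The stationary Bellman equation via the least supersolution -/

section Bellman

variable {V : Fin N → Finset (Fin N)} {L : (i : Fin N) → (V i → ℝ≥0) → EReal}

/-- `v` is a supersolution of the stationary Bellman equation `-r v_i + H(i, v - v_i) = 0`. -/
def IsSupersolution (L : (i : Fin N) → (V i → ℝ≥0) → EReal) (r : ℝ) (v : Fin N → ℝ) : Prop :=
  ∀ i (l : V i → ℝ≥0), ((∑ j, (l j : ℝ) * (v j - v i) - r * v i : ℝ) : EReal) ≤ L i l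

/-- At a node minimizing `v` the jump term is non-negative, so a control of finite cost there bounds
`-r v` from above. -/
lemma exists_bounded_below_of_supersolution (hL : CostAssumptions V L) {r : ℝ} (hr : 0 < r) :
    ∃ a : ℝ, ∀ v, IsSupersolution L r v → ∀ i, a ≤ v i := by
  choose l hl hl' using hL.nondegenerate
  refine ⟨-(∑ i, |(L i (l i)).toReal|) / r, fun v hv i => ?_⟩
  obtain ⟨k, -, hk⟩ := Finset.exists_min_image Finset.univ v ⟨i, Finset.mem_univ i⟩
  refine le_trans ?_ (hk i (Finset.mem_univ i))
  have h1 := hv k (l k)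
  have h2 : (0 : ℝ) ≤ ∑ j, (l k j : ℝ) * (v j - v k) :=
    Finset.sum_nonneg fun j _ => mul_nonneg (NNReal.coe_nonneg _)
      (sub_nonneg.2 (hk j (Finset.mem_univ _)))
  have h3 : -(r * v k) ≤ (L k (l k)).toReal := by
    have h4 : ((∑ j, (l k j : ℝ) * (v j - v k) - r * v k : ℝ) : EReal) ≤
        ((L k (l k)).toReal : EReal) := h1.trans (EReal.le_coe_toReal (hl' k).ne)
    have := EReal.coe_le_coe_iff.1 h4
    linarith
  have h5 : |(L k (l k)).toReal| ≤ ∑ i, |(L i (l i)).toReal| :=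
    Finset.single_le_sum (f := fun i => |(L i (l i)).toReal|) (fun i _ => abs_nonneg _)
      (Finset.mem_univ k)
  rw [div_le_iff₀ hr]
  have := le_abs_self (L k (l k)).toReal
  linarith [mul_comm r (v k)]

lemma exists_supersolution (hL : CostAssumptions V L) {r : ℝ} (hr : 0 < r) :
    ∃ v, IsSupersolution L r v := by
  obtain ⟨C, hC⟩ := hL.bounded_below
  refine ⟨fun _ => -C / r, fun i l => le_trans (le_of_eq ?_) (hC i l)⟩
  simp only [sub_self, mul_zero, Finset.sum_const_zero, zero_sub]
  congr 1
  field_simp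

/-- The least supersolution exists. -/
lemma exists_least_supersolution (hL : CostAssumptions V L) {r : ℝ} (hr : 0 < r) :
    ∃ u, IsSupersolution L r u ∧ ∀ v, IsSupersolution L r v → ∀ i, u i ≤ v i := by
  obtain ⟨a, ha⟩ := exists_bounded_below_of_supersolution hL hr
  obtain ⟨v₀, hv₀⟩ := exists_supersolution hL hr
  have hbdd : ∀ i, BddBelow ((fun v : Fin N → ℝ => v i) '' {v | IsSupersolution L r v}) := by
    rintro i
    refine ⟨a, ?_⟩
    rintro _ ⟨v, hv, rfl⟩
    exact ha v hv i
  have hle : ∀ v, IsSupersolution L r v → ∀ i,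
      sInf ((fun v : Fin N → ℝ => v i) '' {v | IsSupersolution L r v}) ≤ v i :=
    fun v hv i => csInf_le (hbdd i) ⟨v, hv, rfl⟩
  refine ⟨fun i => sInf ((fun v : Fin N → ℝ => v i) '' {v | IsSupersolution L r v}), ?_, hle⟩
  set u : Fin N → ℝ := fun i => sInf ((fun v : Fin N → ℝ => v i) '' {v | IsSupersolution L r v})
  intro i l
  rcases eq_or_ne (L i l) ⊤ with h | h
  · rw [h]; exact le_top
  obtain ⟨C, hC⟩ := hL.bounded_below
  have hbot : L i l ≠ ⊥ := ne_bot_of_le_ne_bot (EReal.coe_ne_bot C) (hC i l)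
  rw [← EReal.coe_toReal h hbot, EReal.coe_le_coe_iff]
  set c := (L i l).toReal
  have hpos : 0 < r + ∑ j, (l j : ℝ) :=
    add_pos_of_pos_of_nonneg hr (Finset.sum_nonneg fun j _ => NNReal.coe_nonneg _)
  -- Solved for `v i`, the inequality has a left side monotone in `v`, so it passes to the infimum.
  have key : (∑ j, (l j : ℝ) * u j - c) / (r + ∑ j, (l j : ℝ)) ≤ u i := by
    refine le_csInf ⟨_, v₀, hv₀, rfl⟩ ?_
    rintro _ ⟨v, hv, rfl⟩
    rw [div_le_iff₀ hpos]
    have h1 := hv i l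
    rw [← EReal.coe_toReal h hbot, EReal.coe_le_coe_iff] at h1
    have h2 : ∑ j, (l j : ℝ) * u j ≤ ∑ j, (l j : ℝ) * v j :=
      Finset.sum_le_sum fun j _ => mul_le_mul_of_nonneg_left (hle v hv j) (NNReal.coe_nonneg _)
    simp only [mul_sub, Finset.sum_sub_distrib, ← Finset.sum_mul] at h1
    simp only
    linarith
  rw [div_le_iff₀ hpos] at key
  simp only [mul_sub, Finset.sum_sub_distrib, ← Finset.sum_mul]
  linarith

/-- Superlinear growth: outside a box, `L i` dominates `K ‖l‖`. -/
lemma exists_superlinear_bound (hL : CostAssumptions V L) (i : Fin N) (K : ℝ) :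
    ∃ M : ℝ, 1 ≤ M ∧ ∀ l : V i → ℝ≥0, M < ‖fun j => (l j : ℝ)‖ →
      ((K * ‖fun j => (l j : ℝ)‖ : ℝ) : EReal) ≤ L i l := by
  have h := (hL.superlinear i).eventually (lt_mem_nhds (EReal.coe_lt_top K))
  rw [eventually_comap] at h
  obtain ⟨M, hM⟩ := eventually_atTop.1 h
  refine ⟨max M 1, le_max_right _ _, fun l hl => ?_⟩
  have h1 := hM _ ((le_max_left _ _).trans hl.le) l rfl
  have hpos : 0 < ‖fun j => (l j : ℝ)‖ := by linarith [le_max_right M 1]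
  have := (EReal.le_div_iff_mul_le (by exact_mod_cast hpos) (EReal.coe_ne_top _)).1 h1.le
  exact_mod_cast this

/-- If the Bellman inequality is strict at the node `i`, there is a uniform gap. -/
lemma exists_gap (hL : CostAssumptions V L) {r : ℝ} (hr : 0 < r) (u : Fin N → ℝ) (i : Fin N)
    (hu : ∀ l : V i → ℝ≥0, ((∑ j, (l j : ℝ) * (u j - u i) - r * u i : ℝ) : EReal) < L i l) :
    ∃ ε : ℝ, 0 < ε ∧ ∀ l : V i → ℝ≥0,
      ((∑ j, (l j : ℝ) * (u j - (u i - ε)) - r * (u i - ε) : ℝ) : EReal) ≤ L i l := by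
  -- For `‖l‖ ≥ 1` and `ε ≤ 1`, `K ‖l‖` dominates the left side of the lowered inequality.
  set K : ℝ := ∑ j : V i, (|u j - u i| + 1) + |r * u i| + r with hK
  obtain ⟨M, hM1, hM⟩ := exists_superlinear_bound hL i K
  have hM0 : 0 ≤ M := by linarith
  set box : Set (V i → ℝ≥0) := Set.Icc 0 (fun _ => M.toNNReal) with hbox
  have hmem : ∀ l : V i → ℝ≥0, l ∉ box → M < ‖fun j => (l j : ℝ)‖ := by
    intro l hl
    by_contra hcon
    push Not at hcon
    refine hl ⟨fun j => zero_le, fun j => ?_⟩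
    have := (norm_le_pi_norm (fun j => (l j : ℝ)) j).trans hcon
    rw [Real.norm_of_nonneg (NNReal.coe_nonneg _)] at this
    exact NNReal.le_toNNReal_of_coe_le this
  have hcont : Continuous fun l : V i → ℝ≥0 =>
      (-(∑ j, (l j : ℝ) * (u j - u i) - r * u i) : ℝ) := by fun_prop
  have hlsc : LowerSemicontinuous fun l : V i → ℝ≥0 =>
      L i l + ((-(∑ j, (l j : ℝ) * (u j - u i) - r * u i) : ℝ) : EReal) := by
    refine LowerSemicontinuous.add' (hL.lowerSemicontinuous i)
      (continuous_coe_real_ereal.comp hcont).lowerSemicontinuous fun l => ?_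
    exact EReal.continuousAt_add (Or.inr (EReal.coe_ne_bot _)) (Or.inr (EReal.coe_ne_top _))
  obtain ⟨l₀, hl₀, hmin⟩ := (hlsc.lowerSemicontinuousOn box).exists_isMinOn
    (show box.Nonempty from ⟨0, le_rfl, fun _ => zero_le⟩) isCompact_Icc
  have hpos : (0 : EReal) < L i l₀ +
      ((-(∑ j, (l₀ j : ℝ) * (u j - u i) - r * u i) : ℝ) : EReal) := by
    rw [EReal.coe_neg, ← sub_eq_add_neg]
    exact EReal.sub_pos.2 (hu l₀)
  obtain ⟨m, hm0, hm⟩ := EReal.lt_iff_exists_real_btwn.1 hpos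
  have hm0 : 0 < m := by exact_mod_cast hm0
  -- Lowering `u i` by `ε` raises the left side by `ε (r + ∑ l_j)`, which is at most `ε D` on the
  -- box; hence `m / D` below.
  set D : ℝ := r + ∑ _j : V i, M with hD
  have hD0 : 0 < D := add_pos_of_pos_of_nonneg hr (Finset.sum_nonneg fun _ _ => hM0)
  refine ⟨min 1 (m / D), by positivity, fun l => ?_⟩
  set ε := min 1 (m / D)
  have hε0 : 0 < ε := by positivity
  have hsplit : ∑ j, (l j : ℝ) * (u j - (u i - ε)) - r * (u i - ε) =
      (∑ j, (l j : ℝ) * (u j - u i) - r * u i) + ε * (r + ∑ j, (l j : ℝ)) := by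
    simp only [mul_sub, Finset.sum_sub_distrib, ← Finset.sum_mul]
    ring
  by_cases hl : l ∈ box
  · have h1 : m < L i l + ((-(∑ j, (l j : ℝ) * (u j - u i) - r * u i) : ℝ) : EReal) :=
      hm.trans_le (hmin hl)
    have h2 : ((∑ j, (l j : ℝ) * (u j - u i) - r * u i + m : ℝ) : EReal) ≤ L i l := by
      rw [EReal.coe_neg, ← sub_eq_add_neg] at h1
      have := EReal.add_le_of_le_sub h1.le
      rw [add_comm, EReal.coe_add]
      exact_mod_cast this
    refine le_trans ?_ h2
    rw [EReal.coe_le_coe_iff, hsplit]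
    have h3 : ∑ j, (l j : ℝ) ≤ ∑ _j : V i, M := by
      refine Finset.sum_le_sum fun j _ => ?_
      have := hl.2 j
      rw [← Real.coe_toNNReal M hM0]
      exact_mod_cast this
    have h4 : ε * (r + ∑ j, (l j : ℝ)) ≤ m / D * D := by
      refine mul_le_mul (min_le_right _ _) (by rw [hD]; linarith)
        (add_nonneg hr.le (Finset.sum_nonneg fun _ _ => NNReal.coe_nonneg _)) (by positivity)
    rw [div_mul_cancel₀ _ hD0.ne'] at h4
    linarith
  · have hl' := hmem l hl
    refine le_trans ?_ (hM l hl')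
    rw [EReal.coe_le_coe_iff, hsplit]
    set n := ‖fun j => (l j : ℝ)‖
    have hn1 : 1 ≤ n := by linarith
    have hln : ∀ j, (l j : ℝ) ≤ n := fun j => by
      have := norm_le_pi_norm (fun j => (l j : ℝ)) j
      rwa [Real.norm_of_nonneg (NNReal.coe_nonneg _)] at this
    have h1 : ∑ j, (l j : ℝ) * (u j - u i) + 1 * ∑ j, (l j : ℝ) ≤
        ∑ j : V i, (|u j - u i| + 1) * n := by
      rw [Finset.mul_sum, ← Finset.sum_add_distrib]
      refine Finset.sum_le_sum fun j _ => ?_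
      calc (l j : ℝ) * (u j - u i) + 1 * (l j : ℝ) = (l j : ℝ) * ((u j - u i) + 1) := by ring
        _ ≤ (l j : ℝ) * (|u j - u i| + 1) := by gcongr; exact le_abs_self _
        _ ≤ n * (|u j - u i| + 1) := by gcongr; exact hln j
        _ = _ := mul_comm _ _
    have h2 : ε * (r + ∑ j, (l j : ℝ)) ≤ 1 * (r + ∑ j, (l j : ℝ)) :=
      mul_le_mul_of_nonneg_right (min_le_left _ _)
        (add_nonneg hr.le (Finset.sum_nonneg fun _ _ => NNReal.coe_nonneg _))
    rw [← Finset.sum_mul] at h1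
    have h3 : -(r * u i) ≤ |r * u i| * n :=
      (neg_le_abs _).trans (le_mul_of_one_le_right (abs_nonneg _) hn1)
    have h4 : r ≤ r * n := le_mul_of_one_le_right hr.le hn1
    rw [hK, add_mul, add_mul]
    linarith

/-- The stationary Bellman equation has a solution, and the supremum in its Hamiltonian is
attained. -/
lemma exists_bellman_solution (hL : CostAssumptions V L) {r : ℝ} (hr : 0 < r) :
    ∃ u, IsSupersolution L r u ∧ ∀ i, ∃ l : V i → ℝ≥0,
      L i l = ((∑ j, (l j : ℝ) * (u j - u i) - r * u i : ℝ) : EReal) := by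
  obtain ⟨u, hu, hmin⟩ := exists_least_supersolution hL hr
  refine ⟨u, hu, fun i => ?_⟩
  by_contra! hcon
  obtain ⟨ε, hε, h⟩ := exists_gap hL hr u i fun l => lt_of_le_of_ne (hu i l) (hcon l).symm
  -- At the other nodes `u i` enters with a non-negative coefficient, so lowering it only relaxes
  -- their inequalities.
  have hv : IsSupersolution L r (Function.update u i (u i - ε)) := by
    intro k l
    have hle : ∀ j, Function.update u i (u i - ε) j ≤ u j := fun j => by
      rcases eq_or_ne j i with rfl | hj
      · simp [hε.le]
      · simp [hj]
    rcases eq_or_ne k i with rfl | hk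
    · refine le_trans ?_ (h l)
      rw [EReal.coe_le_coe_iff, Function.update_self]
      gcongr with j
      exact hle j
    · refine le_trans ?_ (hu k l)
      rw [EReal.coe_le_coe_iff, Function.update_of_ne hk]
      gcongr with j
      exact hle j
  have := hmin _ hv i
  rw [Function.update_self] at this
  linarith

lemma hamiltonian_eq_of_attained {r : ℝ} {u : Fin N → ℝ} (hu : IsSupersolution L r u) {i : Fin N}
    {l : V i → ℝ≥0} (hl : L i l = ((∑ j, (l j : ℝ) * (u j - u i) - r * u i : ℝ) : EReal)) :
    hamiltonian L i (fun j => u j - u i) = ((r * u i : ℝ) : EReal) := by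
  refine le_antisymm (iSup_le fun m => ?_) ?_
  · have := hu i m
    rw [EReal.coe_sub] at this
    refine EReal.sub_le_of_le_add ?_
    rw [add_comm]
    exact (EReal.sub_le_iff_le_add (Or.inl (EReal.coe_ne_bot _))
      (Or.inl (EReal.coe_ne_top _))).1 this
  · refine le_iSup_of_le l ?_
    rw [hl, ← EReal.coe_sub, EReal.coe_le_coe_iff]
    linarith

end Bellman

/-! ### Extended-real integrals and discounting -/

section Integral

variable {α : Type} [MeasurableSpace α] {μ : Measure α}

/-- `lintegral` is monotone on arbitrary functions, and so is `EReal` subtraction at infinite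
values. Costs can thus be compared without measurability or integrability. -/
lemma eintegral_mono {f g : α → EReal} (h : f ≤ g) : eintegral μ f ≤ eintegral μ g := by
  refine EReal.sub_le_sub ?_ ?_
  · exact EReal.coe_ennreal_le_coe_ennreal_iff.2
      (lintegral_mono fun a => EReal.toENNReal_le_toENNReal (h a))
  · exact EReal.coe_ennreal_le_coe_ennreal_iff.2
      (lintegral_mono fun a => EReal.toENNReal_le_toENNReal (EReal.neg_le_neg_iff.2 (h a)))

lemma eintegral_coe {f : α → ℝ} (hf : Integrable f μ) :
    eintegral μ (fun a => (f a : EReal)) = ((∫ a, f a ∂μ : ℝ) : EReal) := by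
  unfold eintegral
  simp only [← EReal.coe_neg, EReal.real_coe_toENNReal]
  have h1 : ∫⁻ a, ENNReal.ofReal (f a) ∂μ ≠ ⊤ := hf.lintegral_lt_top.ne
  have h2 : ∫⁻ a, ENNReal.ofReal (-f a) ∂μ ≠ ⊤ := hf.neg.lintegral_lt_top.ne
  rw [integral_eq_lintegral_pos_part_sub_lintegral_neg_part hf, EReal.coe_sub,
    EReal.coe_ennreal_toReal h1, EReal.coe_ennreal_toReal h2]

end Integral

/-- Discounting an absolutely continuous function, in integral form. -/
lemma integral_exp_mul_sub_eq {φ F : ℝ → ℝ} {t T r c : ℝ} (htT : t ≤ T)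
    (hφ : IntervalIntegrable φ volume t T)
    (hF : ∀ s ∈ Set.Icc t T, F s = c + ∫ v in t..s, φ v) :
    ∫ s in t..T, Real.exp (-r * (s - t)) * (φ s - r * F s) =
      Real.exp (-r * (T - t)) * F T - c := by
  set G : ℝ → ℝ := fun s => c + ∫ v in t..s, φ v with hG
  set e : ℝ → ℝ := fun s => Real.exp (-r * (s - t)) with he
  have hder : ∀ s, HasDerivAt e (-r * e s) s := fun s => by
    have := ((((hasDerivAt_id s).sub_const t).const_mul (-r)).exp)
    simpa [he, mul_comm] using this
  have hce : Continuous e := by fun_prop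
  have hac_e : AbsolutelyContinuousOnInterval e t T := by
    have h : ContDiffOn ℝ 1 e (Set.uIcc t T) := by
      apply ContDiff.contDiffOn
      fun_prop
    obtain ⟨K, hK⟩ := h.exists_lipschitzOnWith one_ne_zero (convex_uIcc t T) isCompact_uIcc
    exact hK.absolutelyContinuousOnInterval
  have hac_I := hφ.absolutelyContinuousOnInterval_intervalIntegral (c := t) (by simp)
  have hac_G : AbsolutelyContinuousOnInterval G t T := by
    have hc : AbsolutelyContinuousOnInterval (fun _ : ℝ => c) t T :=
      (LipschitzWith.const c (α := ℝ)).lipschitzOnWith.absolutelyContinuousOnInterval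
    exact hc.add hac_I
  -- As `φ` is only integrable, `F` is differentiable only almost everywhere; the product rule is
  -- applied in its absolutely continuous form.
  have key := AbsolutelyContinuousOnInterval.integral_deriv_mul_eq_sub hac_e hac_G
  have h1 : G t = c := by simp [hG]
  have h2 : e t = 1 := by simp [he]
  rw [h1, h2, one_mul] at key
  rw [hF T ⟨htT, le_rfl⟩]
  change _ = e T * G T - c
  rw [← key]
  refine intervalIntegral.integral_congr_ae ?_
  filter_upwards [hφ.ae_hasDerivAt_integral] with s hs hsm
  have hs' := (hs (Set.uIoc_subset_uIcc hsm) t (by simp)).const_add c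
  rw [(hder s).deriv, hs'.deriv]
  have hsI : s ∈ Set.Icc t T := by
    rw [← Set.uIcc_of_le htT]; exact Set.uIoc_subset_uIcc hsm
  rw [hF s hsI]
  ring

/-! ### Joint measurability and Fubini along paths -/

section Path

variable {Ω : Type} [MeasurableSpace Ω] {P : Measure Ω}

/-- A right-continuous process is jointly measurable. -/
lemma measurable_clamp_of_right_continuous {t T : ℝ} (htT : t ≤ T) {X : ℝ → Ω → Fin N}
    (hX : ∀ s ∈ Set.Icc t T, Measurable (X s))
    (hrc : ∀ ω, ∀ s ∈ Set.Icc t T,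
      ContinuousWithinAt (fun u => X u ω) (Set.Icc t T ∩ Set.Ici s) s) :
    Measurable fun p : ℝ × Ω => X (min T (max t p.1)) p.2 := by
  -- Nothing is assumed of `X` outside `[t, T]`, so time is clamped to that interval.
  set cl : ℝ → ℝ := fun s => min T (max t s) with hcl
  have hclm : Monotone cl := fun a b h => min_le_min le_rfl (max_le_max le_rfl h)
  have hclI : ∀ s, cl s ∈ Set.Icc t T := fun s =>
    ⟨le_min htT (le_max_left _ _), min_le_left _ _⟩
  have hclc : Continuous cl := by fun_prop
  -- The next point of the grid of mesh `1 / (n + 1)`: it takes countably many values and tends to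
  -- `s` from the right, where paths are continuous.
  set σ : ℕ → ℝ → ℝ := fun n s => ((⌊((n : ℝ) + 1) * s⌋ : ℝ) + 1) / ((n : ℝ) + 1) with hσ
  refine measurable_of_tendsto_metrizable (f := fun n (p : ℝ × Ω) => X (cl (σ n p.1)) p.2)
    (fun n => ?_) ?_
  · have h1 : Measurable fun q : ℤ × Ω => X (cl (((q.1 : ℝ) + 1) / ((n : ℝ) + 1))) q.2 :=
      measurable_from_prod_countable_right fun k =>
        hX (cl (((k : ℝ) + 1) / ((n : ℝ) + 1))) (hclI _)
    have h2 : Measurable fun p : ℝ × Ω => (⌊((n : ℝ) + 1) * p.1⌋, p.2) :=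
      (Int.measurable_floor.comp (measurable_fst.const_mul _)).prodMk measurable_snd
    exact h1.comp h2
  · rw [tendsto_pi_nhds]
    rintro ⟨s, ω⟩
    have hle : ∀ n, s ≤ σ n s := fun n => by
      have hn : (0 : ℝ) < (n : ℝ) + 1 := by positivity
      rw [hσ, le_div_iff₀ hn, mul_comm]
      exact (Int.lt_floor_add_one _).le
    have hup : ∀ n, σ n s ≤ s + 1 / ((n : ℝ) + 1) := fun n => by
      have hn : (0 : ℝ) < (n : ℝ) + 1 := by positivity
      simp only [hσ]
      rw [div_le_iff₀ hn, add_mul s, div_mul_cancel₀ _ hn.ne', mul_comm s]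
      linarith [Int.floor_le (((n : ℝ) + 1) * s)]
    have hlim : Tendsto (fun n => σ n s) atTop (𝓝 s) := by
      refine tendsto_of_tendsto_of_tendsto_of_le_of_le tendsto_const_nhds ?_ hle hup
      simpa using tendsto_const_nhds.add (tendsto_one_div_add_atTop_nhds_zero_nat (𝕜 := ℝ))
    have hlim' : Tendsto (fun n => cl (σ n s)) atTop (𝓝[Set.Icc t T ∩ Set.Ici (cl s)] cl s) :=
      tendsto_nhdsWithin_iff.2 ⟨(hclc.tendsto s).comp hlim,
        Eventually.of_forall fun n => ⟨hclI _, hclm (hle n)⟩⟩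
    exact (hrc ω (cl s) (hclI s)).tendsto.comp hlim'

/-- Splitting along the finitely many level sets of `Y` leaves a sum of indicators times integrable
functions. -/
lemma integrable_comp_finite_valued {β : Type} [MeasurableSpace β] {μ : Measure β}
    {Y : β → Fin N} (hY : Measurable Y) {b : β → Fin N → ℝ}
    (hb : ∀ k, Integrable (fun s => b s k) μ) : Integrable (fun p => b p (Y p)) μ := by
  have h : (fun p => b p (Y p)) = fun p => ∑ k, (Y ⁻¹' {k}).indicator (fun p => b p k) p := by
    ext p
    rw [Finset.sum_eq_single (Y p)]
    · simp
    · intro k _ hk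
      simp [Ne.symm hk]
    · simp
  rw [h]
  exact integrable_finsetSum _ fun k _ => (hb k).indicator (hY (measurableSet_singleton k))

lemma integrable_uncurry_path [IsProbabilityMeasure P] {t T : ℝ} {Y : ℝ × Ω → Fin N}
    (hY : Measurable Y) {b : ℝ → Fin N → ℝ}
    (hb : ∀ k, IntegrableOn (fun s => b s k) (Set.Icc t T)) :
    Integrable (fun p : ℝ × Ω => b p.1 (Y p)) ((volume.restrict (Set.Icc t T)).prod P) :=
  integrable_comp_finite_valued (b := fun p k => b p.1 k) hY fun k => (hb k).comp_fst P

lemma integral_comp_finite_valued [IsProbabilityMeasure P] {Y : Ω → Fin N} (hY : Measurable Y)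
    (f : Fin N → ℝ) : ∫ ω, f (Y ω) ∂P = ∑ k, P.real {ω | Y ω = k} * f k := by
  rw [← integral_map (φ := Y) hY.aemeasurable (measurable_of_finite f).aestronglyMeasurable]
  have := Measure.isProbabilityMeasure_map (μ := P) hY.aemeasurable
  rw [integral_fintype .of_finite]
  refine Finset.sum_congr rfl fun k _ => ?_
  rw [map_measureReal_apply hY (measurableSet_singleton k)]
  rfl

lemma integral_integral_path [IsProbabilityMeasure P] {t T : ℝ} {Y : ℝ × Ω → Fin N}
    (hY : Measurable Y) {b : ℝ → Fin N → ℝ}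
    (hb : ∀ k, IntegrableOn (fun s => b s k) (Set.Icc t T)) :
    ∫ ω, (∫ s in Set.Icc t T, b s (Y (s, ω))) ∂P =
      ∫ s in Set.Icc t T, ∑ k, P.real {ω | Y (s, ω) = k} * b s k := by
  rw [← integral_integral_swap (f := fun s ω => b s (Y (s, ω)))
    (integrable_uncurry_path hY hb)]
  congr 1
  ext s
  exact integral_comp_finite_valued (hY.comp measurable_prodMk_left) (b s)

end Path

/-! ### Dynkin's formula -/

section Dynkin

variable {V : Fin N → Finset (Fin N)}

lemma generator_mulVec (l : Intensities V) (u : Fin N → ℝ) (i : Fin N) :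
    ∑ k, generator l i k * u k = ∑ j : V i, (l i j : ℝ) * (u j - u i) := by
  simp only [generator, sub_mul, Finset.sum_sub_distrib, ite_mul, zero_mul, Finset.sum_ite_eq,
    Finset.mem_univ, if_true, mul_sub, dite_mul]
  congr 1
  · have h : ∀ j : V i, (l i j : ℝ) * u j =
        (fun k : Fin N => if h : k ∈ V i then (l i ⟨k, h⟩ : ℝ) * u k else 0) j := fun j => by simp
    rw [Finset.sum_congr rfl fun j _ => h j,
      Finset.sum_coe_sort (V i) (fun k : Fin N => if h : k ∈ V i then (l i ⟨k, h⟩ : ℝ) * u k else 0)]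
    symm
    refine Finset.sum_subset (Finset.subset_univ _) fun k _ hk => ?_
    simp [hk]
  · rw [Finset.sum_mul]

/-- The affine lower bound of the running cost given by the Bellman equation. -/
def bellmanRate (l : ℝ → Intensities V) (u : Fin N → ℝ) (r s : ℝ) (k : Fin N) : ℝ :=
  ∑ j : V k, (l s k j : ℝ) * (u j - u k) - r * u k

variable {l : ℝ → Intensities V} {t T : ℝ}

lemma integrableOn_exp_mul_bellmanRate (hl : l ∈ admissible V t T) (u : Fin N → ℝ) (r : ℝ)
    (k : Fin N) :
    IntegrableOn (fun s => Real.exp (-r * (s - t)) * bellmanRate l u r s k) (Set.Icc t T) := by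
  refine IntegrableOn.continuousOn_mul (Continuous.continuousOn (by fun_prop)) ?_ isCompact_Icc
  refine Integrable.sub (integrable_finsetSum _ fun j _ => (hl k j).mul_const _) ?_
  exact continuousOn_const.integrableOn_Icc

variable {Ω : Type} [MeasurableSpace Ω] {P : Measure Ω} {X : ℝ → Ω → Fin N} {i : Fin N}

lemma IsMarkovChain.measureReal_eq [IsProbabilityMeasure P] {S : Set ℝ}
    (hX : IsMarkovChain P S t i l X) (ht : t ∈ S) :
    ∃ p, IsTransitionFunction S l p ∧
      ∀ s ∈ S, t ≤ s → ∀ k, P.real {ω | X s ω = k} = p t s i k := by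
  obtain ⟨p, hp, hmk⟩ := hX.markov
  refine ⟨p, hp, fun s hs hts k => ?_⟩
  -- The Markov property with the single past time `t`, where the state is almost surely `i`.
  have h := hmk 0 (fun _ => t) (fun _ => i) (fun _ _ _ => le_rfl) (fun _ => ht) s hs hts k
  have h1 : P.real {ω | ∀ _ : Fin (0 + 1), X t ω = i} = 1 := by
    rw [measureReal_congr (t := Set.univ)]
    · simp
    · filter_upwards [hX.initial] with ω hω
      exact propext ⟨fun _ => trivial, fun _ _ => hω⟩
  rw [h1, one_mul] at h
  rw [← h]
  refine measureReal_congr ?_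
  filter_upwards [hX.initial] with ω hω
  exact propext ⟨fun h => ⟨fun _ => hω, h⟩, fun h => h.2⟩

/-- Dynkin's formula for the discounted chain. -/
lemma IsMarkovChain.dynkin [IsProbabilityMeasure P] (htT : t ≤ T) (hl : l ∈ admissible V t T)
    (hX : IsMarkovChain P (Set.Icc t T) t i l X) (u : Fin N → ℝ) (r : ℝ) :
    (∀ ω, IntegrableOn (fun s => Real.exp (-r * (s - t)) * bellmanRate l u r s (X s ω))
      (Set.Icc t T)) ∧
    Integrable (fun ω => ∫ s in Set.Icc t T,
      Real.exp (-r * (s - t)) * bellmanRate l u r s (X s ω)) P ∧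
    ∫ ω, (∫ s in Set.Icc t T, Real.exp (-r * (s - t)) * bellmanRate l u r s (X s ω)) ∂P =
      Real.exp (-r * (T - t)) * ∫ ω, u (X T ω) ∂P - u i := by
  have hY := measurable_clamp_of_right_continuous htT hX.measurable hX.right_continuous
  set Y : ℝ × Ω → Fin N := fun p => X (min T (max t p.1)) p.2 with hYdef
  have hYX : ∀ s ∈ Set.Icc t T, ∀ ω, Y (s, ω) = X s ω := fun s hs ω => by
    simp only [hYdef, max_eq_right hs.1, min_eq_right hs.2]
  set b : ℝ → Fin N → ℝ := fun s k => Real.exp (-r * (s - t)) * bellmanRate l u r s k with hb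
  have hbi := integrableOn_exp_mul_bellmanRate hl u r
  have hcongr : ∀ ω, Set.EqOn (fun s => b s (X s ω)) (fun s => b s (Y (s, ω))) (Set.Icc t T) :=
    fun ω s hs => by simp only [hYX s hs ω]
  have hint : ∀ ω, ∫ s in Set.Icc t T, b s (X s ω) = ∫ s in Set.Icc t T, b s (Y (s, ω)) :=
    fun ω => setIntegral_congr_fun measurableSet_Icc (hcongr ω)
  have hprod := integrable_uncurry_path (P := P) hY hbi
  refine ⟨fun ω => ?_, ?_, ?_⟩
  · exact (integrable_comp_finite_valued (hY.comp measurable_prodMk_right) hbi).congr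
      ((ae_restrict_mem measurableSet_Icc).mono fun s hs => (hcongr ω hs).symm)
  · change Integrable (fun ω => ∫ s in Set.Icc t T, b s (X s ω)) P
    simp_rw [hint]
    exact hprod.integral_prod_right
  · change ∫ ω, (∫ s in Set.Icc t T, b s (X s ω)) ∂P = _
    simp_rw [hint]
    rw [integral_integral_path hY hbi]
    obtain ⟨p, hp, hpm⟩ := hX.measureReal_eq ⟨le_rfl, htT⟩
    have htI : t ∈ Set.Icc t T := ⟨le_rfl, htT⟩
    -- `F s` is the expectation of `u (X s)`, and `φ` its density in time by the forward equation.
    set φ : ℝ → ℝ := fun v => ∑ k, (p t v * generator (l v)) i k * u k with hφ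
    set F : ℝ → ℝ := fun s => ∑ k, p t s i k * u k with hF
    have hpc : ∀ k, ContinuousOn (fun s => p t s i k) (Set.Icc t T) := fun k => by
      refine (hp t htI i k).1.mono fun s hs => ⟨hs, hs.1⟩
    have hgen : ∀ m k, IntegrableOn (fun v => generator (l v) m k) (Set.Icc t T) := by
      intro m k
      refine Integrable.sub ?_ ?_
      · by_cases h : k ∈ V m
        · simp only [h, dite_true]
          exact hl m ⟨k, h⟩
        · simp [h]
      · by_cases h : m = k
        · subst h
          simp only [if_true]
          exact integrable_finsetSum _ fun j _ => hl m j
        · simp [h]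
    -- Transition probabilities are continuous on a compact interval, so multiplying by them keeps
    -- the rates integrable.
    have hpg : ∀ k, IntegrableOn (fun v => (p t v * generator (l v)) i k) (Set.Icc t T) := by
      intro k
      simp only [Matrix.mul_apply]
      exact integrable_finsetSum _ fun m _ => IntegrableOn.continuousOn_mul (hpc m) (hgen m k) isCompact_Icc
    have hpgI : ∀ k, ∀ s ∈ Set.Icc t T,
        IntervalIntegrable (fun v => (p t v * generator (l v)) i k) volume t s := by
      intro k s hs
      rw [intervalIntegrable_iff_integrableOn_Icc_of_le hs.1]
      exact (hpg k).mono_set (Set.Icc_subset_Icc_right hs.2)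
    have hφi : IntervalIntegrable φ volume t T := by
      rw [intervalIntegrable_iff_integrableOn_Icc_of_le htT]
      exact integrable_finsetSum _ fun k _ => (hpg k).mul_const _
    have hFφ : ∀ s ∈ Set.Icc t T, F s = u i + ∫ v in t..s, φ v := by
      intro s hs
      simp only [hF, hφ]
      rw [intervalIntegral.integral_finsetSum fun k _ => (hpgI k s hs).mul_const _]
      simp only [intervalIntegral.integral_mul_const]
      simp_rw [fun k => (hp t htI i k).2 s hs hs.1, add_mul, Finset.sum_add_distrib]
      simp [Matrix.one_apply]
    have key := integral_exp_mul_sub_eq (r := r) htT hφi hFφ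
    have hφ' : ∀ v, φ v = ∑ m, p t v i m * ∑ k, generator (l v) m k * u k := by
      intro v
      simp only [hφ, Matrix.mul_apply, Finset.sum_mul, Finset.mul_sum]
      rw [Finset.sum_comm]
      simp only [mul_assoc]
    have hEu : ∫ ω, u (X T ω) ∂P = F T := by
      rw [integral_comp_finite_valued (hX.measurable T ⟨htT, le_rfl⟩) u]
      simp only [hF]
      exact Finset.sum_congr rfl fun k _ => by rw [hpm T ⟨htT, le_rfl⟩ htT k]
    rw [hEu, ← key, intervalIntegral.integral_of_le htT, ← integral_Icc_eq_integral_Ioc]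
    refine setIntegral_congr_fun measurableSet_Icc fun s hs => ?_
    simp only [hφ', hF, bellmanRate, generator_mulVec]
    rw [Finset.mul_sum, ← Finset.sum_sub_distrib, Finset.mul_sum]
    refine Finset.sum_congr rfl fun k _ => ?_
    have hset : {ω | Y (s, ω) = k} = {ω | X s ω = k} := by
      ext ω; simp only [Set.mem_ofPred_eq, hYX s hs ω]
    rw [hset, hpm s hs hs.1 k]
    ring

end Dynkin

/-! ### Verification: comparing payoffs with the Bellman solution -/

section Verification

variable {V : Fin N → Finset (Fin N)} {L : (i : Fin N) → (V i → ℝ≥0) → EReal}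
  {u : Fin N → ℝ} {r t T : ℝ} {l : ℝ → Intensities V}

lemma coe_exp_mul_le {a c : ℝ} {x : EReal} (h : (c : EReal) ≤ x) :
    ((Real.exp a * c : ℝ) : EReal) ≤ ((Real.exp a : ℝ) : EReal) * x := by
  rw [EReal.coe_mul]
  exact mul_le_mul_of_nonneg_left h (by exact_mod_cast (Real.exp_pos a).le)

lemma le_coe_exp_mul {a c : ℝ} {x : EReal} (h : x ≤ (c : EReal)) :
    ((Real.exp a : ℝ) : EReal) * x ≤ ((Real.exp a * c : ℝ) : EReal) := by
  rw [EReal.coe_mul]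
  exact mul_le_mul_of_nonneg_left h (by exact_mod_cast (Real.exp_pos a).le)

lemma le_discountedCost (hu : IsSupersolution L r u) {S : Set ℝ}
    {x : ℝ → Fin N}
    (hx : IntegrableOn (fun s => Real.exp (-r * (s - t)) * bellmanRate l u r s (x s)) S) :
    ((∫ s in S, Real.exp (-r * (s - t)) * bellmanRate l u r s (x s) : ℝ) : EReal) ≤
      discountedCost L r t S l x := by
  rw [← eintegral_coe hx]
  exact eintegral_mono fun s => coe_exp_mul_le (hu _ _)

/-- The feedback intensities `l` attain the supremum in the Hamiltonian. -/
def IsOptimal (L : (i : Fin N) → (V i → ℝ≥0) → EReal) (r : ℝ) (u : Fin N → ℝ)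
    (l : Intensities V) : Prop :=
  ∀ k, L k (l k) = ((∑ j, (l k j : ℝ) * (u j - u k) - r * u k : ℝ) : EReal)

lemma discountedCost_eq {m : Intensities V} (hm : IsOptimal L r u m) {S : Set ℝ}
    {x : ℝ → Fin N}
    (hx : IntegrableOn (fun s => Real.exp (-r * (s - t)) *
      bellmanRate (fun _ => m) u r s (x s)) S) :
    discountedCost L r t S (fun _ => m) x =
      ((∫ s in S, Real.exp (-r * (s - t)) * bellmanRate (fun _ => m) u r s (x s) : ℝ) :
        EReal) := by
  rw [← eintegral_coe hx]
  unfold discountedCost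
  congr 1
  ext s
  rw [hm, ← EReal.coe_mul]
  rfl

/-- Extending an integrable function by a discounted constant beyond `T`. -/
lemma integrableOn_and_integral_discounted_extension (hr : 0 < r) (hT : 0 ≤ T) {h : ℝ → ℝ}
    (hh : IntegrableOn h (Set.Icc 0 T)) (c : ℝ) :
    IntegrableOn (fun s => if s ≤ T then h s else Real.exp (-r * (s - 0)) * c) (Set.Ici 0) ∧
    ∫ s in Set.Ici 0, (if s ≤ T then h s else Real.exp (-r * (s - 0)) * c) =
      (∫ s in Set.Icc 0 T, h s) + Real.exp (-r * T) * (c / r) := by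
  set f : ℝ → ℝ := fun s => if s ≤ T then h s else Real.exp (-r * (s - 0)) * c with hf
  have h1 : Set.EqOn h f (Set.Icc 0 T) := fun s hs => by simp [hf, hs.2]
  have h2 : Set.EqOn (fun s => Real.exp (-r * s) * c) f (Set.Ioi T) := fun s hs => by
    simp [hf, not_le.2 (Set.mem_Ioi.1 hs)]
  have hi1 : IntegrableOn f (Set.Icc 0 T) := hh.congr_fun h1 measurableSet_Icc
  have hi2 : IntegrableOn f (Set.Ioi T) :=
    IntegrableOn.congr_fun ((exp_neg_integrableOn_Ioi T hr).mul_const c) h2 measurableSet_Ioi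
  have hunion : Set.Ici (0 : ℝ) = Set.Icc 0 T ∪ Set.Ioi T := (Set.Icc_union_Ioi_eq_Ici hT).symm
  have hdisj : Disjoint (Set.Icc (0 : ℝ) T) (Set.Ioi T) :=
    Set.disjoint_left.2 fun s hs hs' => absurd hs.2 (not_le.2 hs')
  rw [hunion]
  refine ⟨hi1.union hi2, ?_⟩
  rw [setIntegral_union hdisj measurableSet_Ioi hi1 hi2,
    ← setIntegral_congr_fun measurableSet_Icc h1, ← setIntegral_congr_fun measurableSet_Ioi h2,
    integral_mul_const, integral_exp_mul_Ioi (by linarith)]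
  congr 1
  field_simp

variable {Ω : Type} [MeasurableSpace Ω] {P : Measure Ω} {X : ℝ → Ω → Fin N} {i : Fin N}

lemma IsMarkovChain.mono {S S' : Set ℝ} (h : S' ⊆ S)
    (hX : IsMarkovChain P S t i l X) : IsMarkovChain P S' t i l X where
  measurable s hs := hX.measurable s (h hs)
  right_continuous ω s hs :=
    (hX.right_continuous ω s (h hs)).mono (Set.inter_subset_inter_left _ h)
  left_limits ω s hs := by
    obtain ⟨j, hj⟩ := hX.left_limits ω s (h hs)
    exact ⟨j, hj.mono_left (nhdsWithin_mono _ (Set.inter_subset_inter_left _ h))⟩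
  initial := hX.initial
  markov := by
    obtain ⟨p, hp, hm⟩ := hX.markov
    refine ⟨p, fun s hs i j => ⟨((hp s (h hs) i j).1).mono (Set.inter_subset_inter_left _ h),
      fun v hv hsv => (hp s (h hs) i j).2 v (h hv) hsv⟩, fun n τ x hτ hτS v hv => ?_⟩
    exact hm n τ x hτ (fun k => h (hτS k)) v (h hv)

lemma admissible_of_admissibleInf (hl : l ∈ admissibleInf V 0) (T : ℝ) :
    l ∈ admissible V 0 T := fun i j =>
  (hl i j).integrableOn_compact_subset Set.Icc_subset_Ici_self isCompact_Icc

/-- Once the cost is replaced by `bellmanRate`, Dynkin's formula leaves `u i` and the discounted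
mismatch `g - u` at time `T`. -/
lemma integral_payoff_eq [IsProbabilityMeasure P] (htT : t ≤ T) (hl : l ∈ admissible V t T)
    (hX : IsMarkovChain P (Set.Icc t T) t i l X) (u g : Fin N → ℝ) (r : ℝ) :
    Integrable (fun ω => -(∫ s in Set.Icc t T,
      Real.exp (-r * (s - t)) * bellmanRate l u r s (X s ω)) +
        Real.exp (-r * (T - t)) * g (X T ω)) P ∧
    ∫ ω, (-(∫ s in Set.Icc t T, Real.exp (-r * (s - t)) * bellmanRate l u r s (X s ω)) +
        Real.exp (-r * (T - t)) * g (X T ω)) ∂P =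
      u i + Real.exp (-r * (T - t)) * ∫ ω, (g (X T ω) - u (X T ω)) ∂P := by
  obtain ⟨-, h2, h3⟩ := hX.dynkin htT hl u r
  have hXT := hX.measurable T ⟨htT, le_rfl⟩
  have hint : ∀ f : Fin N → ℝ, Integrable (fun ω => f (X T ω)) P := fun f =>
    integrable_comp_finite_valued (b := fun _ k => f k) hXT fun k => integrable_const _
  refine ⟨h2.neg.add ((hint g).const_mul _), ?_⟩
  rw [integral_add (f := fun ω => -_) h2.neg ((hint g).const_mul _), integral_neg, h3, integral_const_mul,
    integral_sub (hint g) (hint u)]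
  ring

lemma abs_integral_le_of_abs_le [IsProbabilityMeasure P] {f : Fin N → ℝ} {M : ℝ}
    (hM : ∀ k, |f k| ≤ M) (Y : Ω → Fin N) : |∫ ω, f (Y ω) ∂P| ≤ M := by
  have := norm_integral_le_of_norm_le_const (μ := P) (f := fun ω => f (Y ω)) (C := M)
    (Eventually.of_forall fun ω => hM (Y ω))
  simpa using this

/-- Verification, upper bound on a finite horizon. -/
lemma payoff_le [IsProbabilityMeasure P] (hu : IsSupersolution L r u) (htT : t ≤ T)
    (hl : l ∈ admissible V t T) (hX : IsMarkovChain P (Set.Icc t T) t i l X) {g : Fin N → ℝ}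
    {M : ℝ} (hM : ∀ k, |g k - u k| ≤ M) :
    eintegral P (fun ω => -discountedCost L r t (Set.Icc t T) l (fun s => X s ω) +
      ((Real.exp (-r * (T - t)) * g (X T ω) : ℝ) : EReal)) ≤
      ((u i + Real.exp (-r * (T - t)) * M : ℝ) : EReal) := by
  obtain ⟨h1, -, -⟩ := hX.dynkin htT hl u r
  obtain ⟨h4, h5⟩ := integral_payoff_eq htT hl hX u g r
  refine (eintegral_mono fun ω => ?_).trans ((eintegral_coe h4).trans_le ?_)
  · rw [EReal.coe_add, EReal.coe_neg]
    exact add_le_add_left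
      (EReal.neg_le_neg_iff.2 (le_discountedCost hu (h1 ω))) _
  · rw [EReal.coe_le_coe_iff, h5]
    have := (abs_le.1 (abs_integral_le_of_abs_le (P := P) hM (X T))).2
    gcongr

/-- Verification, lower bound on a finite horizon for an optimal feedback. -/
lemma le_payoff [IsProbabilityMeasure P] {m : Intensities V} (hm : IsOptimal L r u m)
    (htT : t ≤ T) (hl : (fun _ => m) ∈ admissible V t T)
    (hX : IsMarkovChain P (Set.Icc t T) t i (fun _ => m) X) {g : Fin N → ℝ}
    {M : ℝ} (hM : ∀ k, |g k - u k| ≤ M) :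
    ((u i - Real.exp (-r * (T - t)) * M : ℝ) : EReal) ≤
    eintegral P (fun ω => -discountedCost L r t (Set.Icc t T) (fun _ => m) (fun s => X s ω) +
      ((Real.exp (-r * (T - t)) * g (X T ω) : ℝ) : EReal)) := by
  obtain ⟨h1, -, -⟩ := hX.dynkin htT hl u r
  obtain ⟨h4, h5⟩ := integral_payoff_eq htT hl hX u g r
  simp_rw [fun ω => discountedCost_eq hm (h1 ω), ← EReal.coe_neg, ← EReal.coe_add]
  rw [eintegral_coe h4, EReal.coe_le_coe_iff, h5]
  have := (abs_le.1 (abs_integral_le_of_abs_le (P := P) hM (X T))).1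
  have h6 := mul_le_mul_of_nonneg_left this (Real.exp_pos (-r * (T - t))).le
  linarith

lemma tendsto_coe_add_exp_mul (hr : 0 < r) (a t M : ℝ) :
    Tendsto (fun T : ℝ => ((a + Real.exp (-r * (T - t)) * M : ℝ) : EReal)) atTop
      (𝓝 (a : EReal)) := by
  refine (continuous_coe_real_ereal.tendsto _).comp ?_
  have h1 : Tendsto (fun T : ℝ => -r * (T - t)) atTop atBot :=
    (tendsto_atTop_add_const_right atTop (-t) tendsto_id).const_mul_atTop_of_neg (by linarith)
  simpa using ((Real.tendsto_exp_atBot.comp h1).mul_const M).const_add a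

/-- Verification, upper bound on the infinite horizon. -/
lemma payoffInf_le [IsProbabilityMeasure P] (hr : 0 < r) (hu : IsSupersolution L r u) {C : ℝ}
    (hC : ∀ k m, (C : EReal) ≤ L k m) (hl : l ∈ admissibleInf V 0)
    (hX : IsMarkovChain P (Set.Ici 0) 0 i l X) :
    eintegral P (fun ω => -discountedCost L r 0 (Set.Ici 0) l (fun s => X s ω)) ≤
      (u i : EReal) := by
  set M : ℝ := ∑ k, |-(C / r) - u k| with hMdef
  have hM : ∀ k, |-(C / r) - u k| ≤ M := fun k =>
    Finset.single_le_sum (f := fun k => |-(C / r) - u k|) (fun _ _ => abs_nonneg _)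
      (Finset.mem_univ k)
  have key : ∀ T : ℝ, 0 ≤ T →
      eintegral P (fun ω => -discountedCost L r 0 (Set.Ici 0) l (fun s => X s ω)) ≤
        ((u i + Real.exp (-r * (T - 0)) * M : ℝ) : EReal) := by
    intro T hT
    have hXT := hX.mono (S' := Set.Icc 0 T) Set.Icc_subset_Ici_self
    have hlT := admissible_of_admissibleInf hl T
    obtain ⟨h1, -, -⟩ := hXT.dynkin hT hlT u r
    -- A constant cost `C` from `T` on amounts to the terminal payoff `-(C / r)`.
    obtain ⟨h4, h5⟩ := integral_payoff_eq hT hlT hXT u (fun _ => -(C / r)) r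
    refine (eintegral_mono fun ω => ?_).trans ((eintegral_coe h4).trans_le ?_)
    · obtain ⟨h6, h7⟩ := integrableOn_and_integral_discounted_extension hr hT (h1 ω) C
      rw [sub_zero, mul_neg, ← neg_add, ← h7, EReal.coe_neg, EReal.neg_le_neg_iff,
        ← eintegral_coe h6]
      refine eintegral_mono fun s => ?_
      dsimp only
      split_ifs
      · exact coe_exp_mul_le (hu _ _)
      · exact coe_exp_mul_le (hC _ _)
    · rw [EReal.coe_le_coe_iff, h5]
      have := (abs_le.1 (abs_integral_le_of_abs_le (P := P) hM (X T))).2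
      gcongr
  have hlim : Tendsto (fun T : ℝ => ((u i + Real.exp (-r * (T - 0)) * M : ℝ) : EReal)) atTop
      (𝓝 (u i : EReal)) := tendsto_coe_add_exp_mul hr _ _ _
  exact ge_of_tendsto hlim (eventually_atTop.2 ⟨0, key⟩)

/-- Verification, lower bound on the infinite horizon for an optimal feedback. -/
lemma le_payoffInf [IsProbabilityMeasure P] (hr : 0 < r) {m : Intensities V}
    (hm : IsOptimal L r u m) (hl : (fun _ => m) ∈ admissibleInf V 0)
    (hX : IsMarkovChain P (Set.Ici 0) 0 i (fun _ => m) X) :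
    (u i : EReal) ≤
      eintegral P (fun ω => -discountedCost L r 0 (Set.Ici 0) (fun _ => m) (fun s => X s ω)) := by
  -- Here `C` bounds the cost from above: under the feedback it takes finitely many values, all
  -- finite.
  obtain ⟨C, hC⟩ : ∃ C : ℝ, ∀ k, L k (m k) ≤ (C : EReal) := by
    refine ⟨∑ k, |∑ j, (m k j : ℝ) * (u j - u k) - r * u k|, fun k => ?_⟩
    rw [hm k, EReal.coe_le_coe_iff]
    exact (le_abs_self _).trans
      (Finset.single_le_sum (f := fun k => |∑ j, (m k j : ℝ) * (u j - u k) - r * u k|)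
        (fun _ _ => abs_nonneg _) (Finset.mem_univ k))
  set M : ℝ := ∑ k, |-(C / r) - u k| with hMdef
  have hM : ∀ k, |-(C / r) - u k| ≤ M := fun k =>
    Finset.single_le_sum (f := fun k => |-(C / r) - u k|) (fun _ _ => abs_nonneg _)
      (Finset.mem_univ k)
  have key : ∀ T : ℝ, 0 ≤ T → ((u i + Real.exp (-r * (T - 0)) * (-M) : ℝ) : EReal) ≤
      eintegral P
        (fun ω => -discountedCost L r 0 (Set.Ici 0) (fun _ => m) (fun s => X s ω)) := by
    intro T hT
    have hXT := hX.mono (S' := Set.Icc 0 T) Set.Icc_subset_Ici_self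
    have hlT := admissible_of_admissibleInf hl T
    obtain ⟨h1, -, -⟩ := hXT.dynkin hT hlT u r
    obtain ⟨h4, h5⟩ := integral_payoff_eq hT hlT hXT u (fun _ => -(C / r)) r
    refine le_trans (le_of_le_of_eq ?_ (eintegral_coe h4).symm) (eintegral_mono fun ω => ?_)
    · rw [EReal.coe_le_coe_iff, h5]
      have := (abs_le.1 (abs_integral_le_of_abs_le (P := P) hM (X T))).1
      gcongr
    · obtain ⟨h6, h7⟩ := integrableOn_and_integral_discounted_extension hr hT (h1 ω) C
      rw [sub_zero, mul_neg, ← neg_add, ← h7, EReal.coe_neg, EReal.neg_le_neg_iff,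
        ← eintegral_coe h6]
      refine eintegral_mono fun s => ?_
      dsimp only
      split_ifs
      · exact le_coe_exp_mul (hm _).le
      · exact le_coe_exp_mul (hC _)
  exact le_of_tendsto (tendsto_coe_add_exp_mul hr _ _ _) (eventually_atTop.2 ⟨0, key⟩)

end Verification

/-! ### Jump paths driven by a sequence of marks -/

section Sequences

/-- Prepend a term to a sequence. -/
def consSeq {A : Type} (a : A) (ω : ℕ → A) : ℕ → A
  | 0 => a
  | n + 1 => ω n

/-- Basis of all first-event decompositions: past the first mark, an i.i.d. sequence is an
independent copy of itself. It is checked on cylinders. -/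
lemma measurePreserving_consSeq {A : Type} [MeasurableSpace A] (η : Measure A)
    [IsProbabilityMeasure η] :
    MeasurePreserving (fun p : A × (ℕ → A) => consSeq p.1 p.2)
      (η.prod (Measure.infinitePi fun _ : ℕ => η)) (Measure.infinitePi fun _ : ℕ => η) := by
  classical
  have hmeas : Measurable (fun p : A × (ℕ → A) => consSeq p.1 p.2) := by
    refine measurable_pi_lambda _ fun n => ?_
    cases n with
    | zero => exact measurable_fst
    | succ n => exact (measurable_pi_apply n).comp measurable_snd
  refine ⟨hmeas, Measure.eq_infinitePi _ fun s t ht => ?_⟩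
  -- Padding the cylinder with `Set.univ` up to an initial segment lets index `0` be split off.
  obtain ⟨n, hn⟩ : ∃ n, s ⊆ Finset.range (n + 1) := by
    obtain ⟨n, hn⟩ := s.exists_nat_subset_range
    exact ⟨n, hn.trans (Finset.range_mono (Nat.le_succ n))⟩
  set t' : ℕ → Set A := fun i => if i ∈ s then t i else Set.univ with ht'
  have ht'm : ∀ i, MeasurableSet (t' i) := fun i => by
    simp only [ht']
    split_ifs
    exacts [ht i, MeasurableSet.univ]
  have hpi : ((s : Set ℕ).pi t) = ((Finset.range (n + 1) : Finset ℕ) : Set ℕ).pi t' := by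
    ext x
    simp only [Set.mem_pi, Finset.mem_coe, ht']
    constructor
    · intro h i _
      split_ifs with hi
      exacts [h i hi, trivial]
    · intro h i hi
      simpa [hi] using h i (hn hi)
  have hprod : ∏ i ∈ s, η (t i) = ∏ i ∈ Finset.range (n + 1), η (t' i) := by
    rw [← Finset.prod_subset hn]
    · exact Finset.prod_congr rfl fun i hi => by simp [ht', hi]
    · intro i _ hi
      simp [ht', hi]
  have hpre : (fun p : A × (ℕ → A) => consSeq p.1 p.2) ⁻¹'
      (((Finset.range (n + 1) : Finset ℕ) : Set ℕ).pi t') =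
      t' 0 ×ˢ (((Finset.range n : Finset ℕ) : Set ℕ).pi fun i => t' (i + 1)) := by
    ext ⟨a, ω⟩
    simp only [Set.mem_preimage, Set.mem_pi, Finset.mem_coe, Finset.mem_range, Set.mem_prod]
    constructor
    · intro h
      exact ⟨h 0 (Nat.succ_pos _), fun i hi => h (i + 1) (Nat.succ_lt_succ hi)⟩
    · rintro ⟨h0, h⟩ i hi
      cases i with
      | zero => exact h0
      | succ i => exact h i (Nat.lt_of_succ_lt_succ hi)
  have hm : MeasurableSet (((Finset.range (n + 1) : Finset ℕ) : Set ℕ).pi t') :=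
    MeasurableSet.pi (Finset.countable_toSet _) fun i _ => ht'm i
  rw [hpi, hprod, Measure.map_apply hmeas hm, hpre, Measure.prod_prod,
    Measure.infinitePi_pi _ fun i _ => ht'm (i + 1), Finset.prod_range_succ', mul_comm]

/-- The marks of the jump construction: a waiting time and a map telling where to jump. -/
abbrev Mark (N : ℕ) : Type := ℝ × (Fin N → Fin N)

/-- The time of the `n`-th event. -/
def eventTime (ω : ℕ → Mark N) (n : ℕ) : ℝ := ∑ k ∈ Finset.range n, (ω k).1

/-- The state after `n` events, starting from `i`. -/
def stateAfter (ω : ℕ → Mark N) (i : Fin N) : ℕ → Fin N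
  | 0 => i
  | n + 1 => (ω n).2 (stateAfter ω i n)

/-- The number of events up to time `t`. -/
def eventCount (ω : ℕ → Mark N) (t : ℝ) : ℕ := sInf {n | t < eventTime ω (n + 1)}

/-- The event times are unbounded. -/
def Nonexplosive (ω : ℕ → Mark N) : Prop := ∀ t, ∃ n, t < eventTime ω (n + 1)

open Classical in
/-- The jump path started from `i`. -/
def jumpPath (ω : ℕ → Mark N) (i : Fin N) (t : ℝ) : Fin N :=
  if Nonexplosive ω then stateAfter ω i (eventCount ω t) else i

lemma eventTime_consSeq (a : Mark N) (ω : ℕ → Mark N) (n : ℕ) :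
    eventTime (consSeq a ω) (n + 1) = a.1 + eventTime ω n := by
  rw [eventTime, Finset.sum_range_succ', add_comm]
  rfl

lemma stateAfter_consSeq (a : Mark N) (ω : ℕ → Mark N) (i : Fin N) (n : ℕ) :
    stateAfter (consSeq a ω) i (n + 1) = stateAfter ω (a.2 i) n := by
  induction n with
  | zero => rfl
  | succ n ih =>
    rw [stateAfter, ih]
    rfl

lemma Nonexplosive.consSeq {ω : ℕ → Mark N} (h : Nonexplosive ω) (a : Mark N) :
    Nonexplosive (consSeq a ω) := by
  intro t
  obtain ⟨n, hn⟩ := h (t - a.1)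
  refine ⟨n + 1, ?_⟩
  rw [eventTime_consSeq]
  linarith

lemma jumpPath_consSeq_of_lt {a : Mark N} {ω : ℕ → Mark N} (h : Nonexplosive ω) (i : Fin N)
    {t : ℝ} (ht : t < a.1) : jumpPath (consSeq a ω) i t = i := by
  have h0 : eventCount (consSeq a ω) t = 0 := by
    refine Nat.sInf_eq_zero.2 (Or.inl ?_)
    change t < eventTime _ _
    rw [eventTime_consSeq]
    simpa [eventTime] using ht
  rw [jumpPath, if_pos (h.consSeq a), h0]
  rfl

/-- Index `0` does not qualify in the count for the extended sequence, and the later indices are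
those for `ω` at time `t - a.1`, shifted by one. Positivity of waiting times is not needed. -/
lemma jumpPath_consSeq_of_le {a : Mark N} {ω : ℕ → Mark N} (h : Nonexplosive ω) (i : Fin N)
    {t : ℝ} (ht : a.1 ≤ t) :
    jumpPath (consSeq a ω) i t = jumpPath ω (a.2 i) (t - a.1) := by
  have h1 : eventCount (consSeq a ω) t = eventCount ω (t - a.1) + 1 := by
    have hne : {n | t - a.1 < eventTime ω (n + 1)}.Nonempty := h (t - a.1)
    have hne' : {n | t < eventTime (consSeq a ω) (n + 1)}.Nonempty := h.consSeq a t
    refine le_antisymm (Nat.sInf_le ?_) ?_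
    · have := Nat.sInf_mem hne
      change t < eventTime _ _
      change t - a.1 < eventTime _ _ at this
      rw [eventTime_consSeq]
      rw [eventCount]
      linarith
    · have hmem := Nat.sInf_mem hne'
      change t < eventTime (consSeq a ω) (eventCount (consSeq a ω) t + 1) at hmem
      rw [eventTime_consSeq] at hmem
      cases hk : eventCount (consSeq a ω) t with
      | zero =>
        rw [hk] at hmem
        simp only [eventTime, Finset.range_zero, Finset.sum_empty, add_zero] at hmem
        linarith
      | succ k =>
        rw [hk] at hmem
        refine Nat.succ_le_succ (Nat.sInf_le ?_)
        change t - a.1 < eventTime _ _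
        linarith
  rw [jumpPath, if_pos (h.consSeq a), jumpPath, if_pos h, h1, stateAfter_consSeq]

/-- Before its first event the path is constant: postponing the first event shifts the path. -/
lemma jumpPath_consSeq_add {e τ : ℝ} {f : Fin N → Fin N} {ω : ℕ → Mark N}
    (h : Nonexplosive ω) (i : Fin N) (d : ℝ) :
    jumpPath (consSeq (e, f) ω) i (τ + d) = jumpPath (consSeq (e - τ, f) ω) i d := by
  rcases lt_or_ge d (e - τ) with hd | hd
  · rw [jumpPath_consSeq_of_lt h i (show τ + d < (e, f).1 by simp only; linarith),
      jumpPath_consSeq_of_lt h i (show d < (e - τ, f).1 from hd)]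
  · rw [jumpPath_consSeq_of_le h i (show (e, f).1 ≤ τ + d by simp only; linarith),
      jumpPath_consSeq_of_le h i (show (e - τ, f).1 ≤ d from hd)]
    congr 1
    ring

lemma Nonexplosive.monotone_eventCount {ω : ℕ → Mark N} (h : Nonexplosive ω) :
    Monotone (eventCount ω) := fun s t hst => by
  refine Nat.sInf_le ?_
  have : t < eventTime ω (eventCount ω t + 1) := Nat.sInf_mem (h t)
  exact hst.trans_lt this

/-- `IsMarkovChain` demands regular paths for every `ω`. On explosive sequences the constant default
provides this; otherwise the count is monotone and constant on a right neighborhood of `t`, even if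
some waiting times are negative. -/
lemma continuousWithinAt_jumpPath (ω : ℕ → Mark N) (i : Fin N) (t : ℝ) :
    ContinuousWithinAt (jumpPath ω i) (Set.Ici t) t := by
  by_cases h : Nonexplosive ω
  · have hlt : t < eventTime ω (eventCount ω t + 1) := Nat.sInf_mem (h t)
    refine (continuousWithinAt_const (b := jumpPath ω i t)).congr_of_eventuallyEq ?_ rfl
    filter_upwards [self_mem_nhdsWithin, mem_nhdsWithin_of_mem_nhds (Iio_mem_nhds hlt)]
      with s hs hs'
    have : eventCount ω s = eventCount ω t :=
      le_antisymm (Nat.sInf_le hs') (h.monotone_eventCount hs)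
    simp only [jumpPath, if_pos h, this]
  · have : jumpPath ω i = fun _ => i := by
      ext s
      simp [jumpPath, h]
    rw [this]
    exact continuousWithinAt_const

/-- The monotone integer-valued count has left limits, and `stateAfter ω i` is continuous on the
discrete space `ℕ`. -/
lemma exists_tendsto_jumpPath (ω : ℕ → Mark N) (i : Fin N) (t : ℝ) :
    ∃ j, Tendsto (jumpPath ω i) (𝓝[<] t) (𝓝 j) := by
  by_cases h : Nonexplosive ω
  · have hK := h.monotone_eventCount.tendsto_nhdsLT t
    refine ⟨stateAfter ω i (sSup (eventCount ω '' Set.Iio t)), ?_⟩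
    have : jumpPath ω i = stateAfter ω i ∘ eventCount ω := by
      ext s
      simp [jumpPath, h]
    rw [this]
    exact ((continuous_of_discreteTopology (f := stateAfter ω i)).tendsto _).comp hK
  · refine ⟨i, ?_⟩
    have : jumpPath ω i = fun _ => i := by
      ext s
      simp [jumpPath, h]
    rw [this]
    exact tendsto_const_nhds

lemma measurable_eventTime (n : ℕ) : Measurable fun ω : ℕ → Mark N => eventTime ω n :=
  Finset.measurable_sum _ fun k _ => measurable_fst.comp (measurable_pi_apply k)

lemma measurable_stateAfter (i : Fin N) (n : ℕ) :
    Measurable fun ω : ℕ → Mark N => stateAfter ω i n := by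
  induction n with
  | zero => exact measurable_const
  | succ n ih =>
    have h : Measurable fun q : (Fin N → Fin N) × Fin N => q.1 q.2 :=
      measurable_from_prod_countable_left fun k => measurable_pi_apply k
    exact h.comp ((measurable_snd.comp (measurable_pi_apply n)).prodMk ih)

lemma measurable_eventCount (t : ℝ) : Measurable fun ω : ℕ → Mark N => eventCount ω t := by
  refine measurable_of_Iic fun n => ?_
  have hm : ∀ m, MeasurableSet {ω : ℕ → Mark N | t < eventTime ω (m + 1)} := fun m =>
    measurableSet_lt measurable_const (measurable_eventTime _)
  -- If no index qualifies, the count is `sInf ∅ = 0`, so such sequences lie in every sublevel set.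
  have : (fun ω : ℕ → Mark N => eventCount ω t) ⁻¹' Set.Iic n =
      (⋃ m ∈ Set.Iic n, {ω | t < eventTime ω (m + 1)}) ∪
        ⋂ m, {ω | t < eventTime ω (m + 1)}ᶜ := by
    ext ω
    simp only [Set.mem_preimage, Set.mem_Iic, Set.mem_union, Set.mem_iUnion, Set.mem_iInter,
      Set.mem_compl_iff, Set.mem_ofPred_eq, exists_prop]
    constructor
    · intro h
      by_cases hne : {n | t < eventTime ω (n + 1)}.Nonempty
      · exact Or.inl ⟨_, h, Nat.sInf_mem hne⟩
      · exact Or.inr fun m hm => hne ⟨m, hm⟩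
    · rintro (⟨m, hm, h⟩ | h)
      · exact (Nat.sInf_le h).trans hm
      · have : {n | t < eventTime ω (n + 1)} = ∅ := Set.eq_empty_of_forall_notMem h
        simp [eventCount, this]
  rw [this]
  exact (MeasurableSet.biUnion (Set.to_countable _) fun m _ => hm m).union
    (MeasurableSet.iInter fun m => (hm m).compl)

lemma nonexplosive_iff_nat (ω : ℕ → Mark N) :
    Nonexplosive ω ↔ ∀ m : ℕ, ∃ n, (m : ℝ) < eventTime ω (n + 1) := by
  refine ⟨fun h m => h m, fun h t => ?_⟩
  obtain ⟨m, hm⟩ := exists_nat_gt t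
  obtain ⟨n, hn⟩ := h m
  exact ⟨n, hm.trans hn⟩

lemma measurableSet_nonexplosive : MeasurableSet {ω : ℕ → Mark N | Nonexplosive ω} := by
  simp only [nonexplosive_iff_nat]
  refine MeasurableSet.congr (s := ⋂ m : ℕ, ⋃ n : ℕ,
    {ω : ℕ → Mark N | (m : ℝ) < eventTime ω (n + 1)}) ?_ ?_
  · exact MeasurableSet.iInter fun m => MeasurableSet.iUnion fun n =>
      measurableSet_lt measurable_const (measurable_eventTime _)
  · ext ω
    simp

lemma measurable_jumpPath (i : Fin N) (t : ℝ) :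
    Measurable fun ω : ℕ → Mark N => jumpPath ω i t := by
  refine Measurable.ite measurableSet_nonexplosive ?_ measurable_const
  have h : Measurable fun q : (ℕ → Mark N) × ℕ => stateAfter q.1 i q.2 :=
    measurable_from_prod_countable_left fun n => measurable_stateAfter i n
  exact h.comp (measurable_id.prodMk (measurable_eventCount t))

end Sequences

/-! ### Renewal equations and the Markov property -/

section Renewal

open ProbabilityTheory

lemma expMeasure_real_Iic {Λ : ℝ} (hΛ : 0 < Λ) (x : ℝ) :
    (expMeasure Λ).real (Set.Iic x) = if 0 ≤ x then 1 - Real.exp (-(Λ * x)) else 0 := by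
  have := isProbabilityMeasure_expMeasure hΛ
  rw [← cdf_expMeasure_eq hΛ, cdf_eq_real]

lemma expMeasure_Iic_zero {Λ : ℝ} (hΛ : 0 < Λ) : expMeasure Λ (Set.Iic 0) = 0 := by
  have := isProbabilityMeasure_expMeasure hΛ
  rw [← measureReal_eq_zero_iff, expMeasure_real_Iic hΛ]
  simp

lemma expMeasure_real_Iic_lt_one {Λ : ℝ} (hΛ : 0 < Λ) (x : ℝ) :
    (expMeasure Λ).real (Set.Iic x) < 1 := by
  rw [expMeasure_real_Iic hΛ]
  split_ifs
  · linarith [Real.exp_pos (-(Λ * x))]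
  · exact one_pos

/-- The exponential distribution is memoryless. -/
lemma map_sub_expMeasure_restrict {Λ : ℝ} (hΛ : 0 < Λ) {τ : ℝ} (hτ : 0 ≤ τ) :
    ((expMeasure Λ).restrict (Set.Ioi τ)).map (fun e => e - τ) =
      ENNReal.ofReal (Real.exp (-(Λ * τ))) • expMeasure Λ := by
  have := isProbabilityMeasure_expMeasure hΛ
  have hm : Measurable fun e : ℝ => e - τ := measurable_id.sub_const τ
  have : IsFiniteMeasure (ENNReal.ofReal (Real.exp (-(Λ * τ))) • expMeasure Λ) :=
    Measure.smul_finite _ ENNReal.ofReal_ne_top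
  refine Measure.ext_of_Iic _ _ fun x => ?_
  rw [Measure.map_apply hm measurableSet_Iic,
    Measure.restrict_apply (hm measurableSet_Iic), Measure.smul_apply, smul_eq_mul,
    ← ENNReal.toReal_eq_toReal_iff' (measure_ne_top _ _)
      (ENNReal.mul_ne_top ENNReal.ofReal_ne_top (measure_ne_top _ _)),
    ENNReal.toReal_mul, ENNReal.toReal_ofReal (Real.exp_pos _).le]
  change (expMeasure Λ).real _ = _ * (expMeasure Λ).real _
  have hset : (fun e : ℝ => e - τ) ⁻¹' Set.Iic x ∩ Set.Ioi τ =
      Set.Iic (x + τ) \ Set.Iic τ := by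
    ext e
    simp [and_comm]
  rw [hset]
  rcases le_or_gt 0 x with hx | hx
  · rw [measureReal_sdiff (Set.Iic_subset_Iic.2 (by linarith)) measurableSet_Iic,
      expMeasure_real_Iic hΛ, expMeasure_real_Iic hΛ, expMeasure_real_Iic hΛ, if_pos hx,
      if_pos hτ, if_pos (by linarith)]
    have : -(Λ * (x + τ)) = -(Λ * τ) + -(Λ * x) := by ring
    rw [this, Real.exp_add]
    ring
  · rw [Set.sdiff_eq_empty.2 (Set.Iic_subset_Iic.2 (by linarith)), expMeasure_real_Iic hΛ,
      if_neg (not_le.2 hx)]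
    simp

variable (Λ : ℝ) (ν : Measure (Fin N → Fin N))

/-- The law of a mark. -/
def markMeasure : Measure (Mark N) := (expMeasure Λ).prod ν

/-- The law of the sequence of marks. -/
def pathMeasure : Measure (ℕ → Mark N) := Measure.infinitePi fun _ => markMeasure Λ ν

lemma isProbabilityMeasure_markMeasure [IsProbabilityMeasure ν] {Λ : ℝ} (hΛ : 0 < Λ) :
    IsProbabilityMeasure (markMeasure Λ ν) := by
  have := isProbabilityMeasure_expMeasure hΛ
  unfold markMeasure
  infer_instance

lemma isProbabilityMeasure_pathMeasure [IsProbabilityMeasure ν] {Λ : ℝ} (hΛ : 0 < Λ) :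
    IsProbabilityMeasure (pathMeasure Λ ν) := by
  have := isProbabilityMeasure_markMeasure ν hΛ
  unfold pathMeasure
  infer_instance

variable {Λ} {ν}

lemma markMeasure_real_le [IsProbabilityMeasure ν] (hΛ : 0 < Λ) (T : ℝ) :
    (markMeasure Λ ν).real {a | a.1 ≤ T} = (expMeasure Λ).real (Set.Iic T) := by
  have := isProbabilityMeasure_expMeasure hΛ
  have h : {a : Mark N | a.1 ≤ T} = Set.Iic T ×ˢ Set.univ := by ext; simp
  rw [markMeasure, h, measureReal_prod_prod]
  simp

lemma ae_pos_markMeasure (hΛ : 0 < Λ) : ∀ᵐ a ∂markMeasure Λ ν, 0 < a.1 := by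
  have := isProbabilityMeasure_expMeasure hΛ
  have h : {a : Mark N | ¬ 0 < a.1} = Set.Iic 0 ×ˢ Set.univ := by ext; simp
  rw [ae_iff, markMeasure, h, Measure.prod_prod, expMeasure_Iic_zero hΛ, zero_mul]

/-- Integration against the law of the first mark given that it occurs after `τ`. -/
lemma setIntegral_markMeasure_gt (hΛ : 0 < Λ) {τ : ℝ} (hτ : 0 ≤ τ) (h : Mark N → ℝ)
    (hh : Integrable h (markMeasure Λ ν)) :
    ∫ a in {a | a.1 ≤ τ}ᶜ, h (a.1 - τ, a.2) ∂markMeasure Λ ν =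
      Real.exp (-(Λ * τ)) * ∫ a, h a ∂markMeasure Λ ν := by
  have := isProbabilityMeasure_expMeasure hΛ
  have hset : {a : Mark N | a.1 ≤ τ}ᶜ = Set.Ioi τ ×ˢ Set.univ := by ext; simp
  have hm : Measurable fun e : ℝ => e - τ := measurable_id.sub_const τ
  have hmap : ((markMeasure Λ ν).restrict {a | a.1 ≤ τ}ᶜ).map (Prod.map (fun e => e - τ) id) =
      ENNReal.ofReal (Real.exp (-(Λ * τ))) • markMeasure Λ ν := by
    rw [hset, markMeasure, ← Measure.prod_restrict, Measure.restrict_univ,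
      ← Measure.map_prod_map _ _ hm measurable_id, map_sub_expMeasure_restrict hΛ hτ,
      Measure.map_id, Measure.prod_smul_left]
  have h1 := integral_map (μ := (markMeasure Λ ν).restrict {a | a.1 ≤ τ}ᶜ)
    (φ := Prod.map (fun e => e - τ) id) (f := h) (hm.prodMap measurable_id).aemeasurable
    (by rw [hmap]; exact hh.aestronglyMeasurable.mono_ac Measure.smul_absolutelyContinuous)
  rw [hmap, integral_smul_measure, ENNReal.toReal_ofReal (Real.exp_pos _).le, smul_eq_mul] at h1
  rw [h1]
  rfl

variable [IsProbabilityMeasure ν]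

/-- Decomposition of a probability at the first mark. -/
lemma pathMeasure_real_eq_integral (hΛ : 0 < Λ) {W : Set (ℕ → Mark N)} (hW : MeasurableSet W) :
    Integrable (fun a => (pathMeasure Λ ν).real {ω | consSeq a ω ∈ W}) (markMeasure Λ ν) ∧
    (pathMeasure Λ ν).real W =
      ∫ a, (pathMeasure Λ ν).real {ω | consSeq a ω ∈ W} ∂markMeasure Λ ν := by
  have := isProbabilityMeasure_markMeasure ν hΛ
  have := isProbabilityMeasure_pathMeasure ν hΛ
  have hmp := measurePreserving_consSeq (markMeasure Λ ν)
  have hW' := hmp.measurable hW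
  have hm : Measurable fun a => pathMeasure Λ ν {ω | consSeq a ω ∈ W} :=
    measurable_measure_prodMk_left hW'
  refine ⟨?_, ?_⟩
  · refine Integrable.of_bound hm.ennreal_toReal.aestronglyMeasurable 1
      (Eventually.of_forall fun a => ?_)
    rw [Real.norm_of_nonneg measureReal_nonneg]
    exact measureReal_le_one
  · have h1 : pathMeasure Λ ν W = ∫⁻ a, pathMeasure Λ ν {ω | consSeq a ω ∈ W} ∂markMeasure Λ ν := by
      rw [pathMeasure, ← hmp.measure_preimage hW.nullMeasurableSet, Measure.prod_apply hW']
      rfl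
    rw [measureReal_def, h1]
    exact (integral_toReal hm.aemeasurable
      (Eventually.of_forall fun a => measure_lt_top _ _)).symm

/-- Almost surely there is no explosion. -/
lemma ae_nonexplosive (hΛ : 0 < Λ) : ∀ᵐ ω ∂pathMeasure Λ ν, Nonexplosive ω := by
  have := isProbabilityMeasure_markMeasure ν hΛ
  have := isProbabilityMeasure_pathMeasure ν hΛ
  have key : ∀ t : ℝ, (pathMeasure Λ ν).real {ω | ∀ n, eventTime ω (n + 1) ≤ t} = 0 := by
    intro t
    set W : Set (ℕ → Mark N) := {ω | ∀ n, eventTime ω (n + 1) ≤ t} with hWdef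
    have hW : MeasurableSet W := by
      refine MeasurableSet.congr (s := ⋂ n, {ω : ℕ → Mark N | eventTime ω (n + 1) ≤ t}) ?_ ?_
      · exact MeasurableSet.iInter fun n =>
          measurableSet_le (measurable_eventTime _) measurable_const
      · ext ω; simp [hWdef]
    have hle : (pathMeasure Λ ν).real W ≤
        (markMeasure Λ ν).real {a | a.1 ≤ t} * (pathMeasure Λ ν).real W := by
      obtain ⟨h1, h2⟩ := pathMeasure_real_eq_integral (ν := ν) hΛ hW
      conv_lhs => rw [h2]
      have hms : MeasurableSet {a : Mark N | a.1 ≤ t} :=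
        measurableSet_le measurable_fst measurable_const
      have : (markMeasure Λ ν).real {a | a.1 ≤ t} * (pathMeasure Λ ν).real W =
          ∫ a, {a : Mark N | a.1 ≤ t}.indicator (fun _ => (pathMeasure Λ ν).real W) a
            ∂markMeasure Λ ν := by
        rw [integral_indicator hms, setIntegral_const, smul_eq_mul]
      rw [this]
      refine integral_mono_ae h1 ((integrable_const _).indicator hms) ?_
      filter_upwards [ae_pos_markMeasure hΛ] with a ha
      by_cases hat : a.1 ≤ t
      · rw [Set.indicator_of_mem (show a ∈ {a : Mark N | a.1 ≤ t} from hat)]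
        refine measureReal_mono fun ω hω n => ?_
        have := hω (n + 1)
        rw [eventTime_consSeq] at this
        linarith
      · rw [Set.indicator_of_notMem (show a ∉ {a : Mark N | a.1 ≤ t} from hat)]
        have : {ω : ℕ → Mark N | consSeq a ω ∈ W} = ∅ := by
          refine Set.eq_empty_of_forall_notMem fun ω hω => hat ?_
          have := hω 0
          rw [eventTime_consSeq] at this
          simpa [eventTime] using this
        simp [this]
    rw [markMeasure_real_le hΛ] at hle
    have h0 : 0 ≤ (pathMeasure Λ ν).real W := measureReal_nonneg
    have h1 := expMeasure_real_Iic_lt_one hΛ t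
    nlinarith
  have h : ∀ m : ℕ, ∀ᵐ ω ∂pathMeasure Λ ν, ∃ n, (m : ℝ) < eventTime ω (n + 1) := by
    intro m
    rw [ae_iff, ← measureReal_eq_zero_iff]
    convert key m using 2
    ext ω
    simp
  filter_upwards [ae_all_iff.2 h] with ω hω
  exact (nonexplosive_iff_nat ω).2 hω

lemma ae_jumpPath_zero (hΛ : 0 < Λ) (i : Fin N) :
    ∀ᵐ ω ∂pathMeasure Λ ν, jumpPath ω i 0 = i := by
  have := isProbabilityMeasure_markMeasure ν hΛ
  have h0 : ∀ᵐ ω ∂pathMeasure Λ ν, 0 < (ω 0).1 :=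
    (measurePreserving_eval_infinitePi (fun _ : ℕ => markMeasure Λ ν) 0).quasiMeasurePreserving.ae
      (ae_pos_markMeasure hΛ)
  filter_upwards [h0, ae_nonexplosive hΛ] with ω hω hne
  have : eventCount ω 0 = 0 := Nat.sInf_eq_zero.2 (Or.inl (by simpa [eventTime] using hω))
  rw [jumpPath, if_pos hne, this]
  rfl

lemma measurableSet_jumpPath_forall {ι : Type} [Countable ι] (i : Fin N) (d : ι → ℝ)
    (y : ι → Fin N) : MeasurableSet {ω : ℕ → Mark N | ∀ k, jumpPath ω i (d k) = y k} := by
  refine MeasurableSet.congr (s := ⋂ k, {ω : ℕ → Mark N | jumpPath ω i (d k) = y k}) ?_ ?_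
  · exact MeasurableSet.iInter fun k =>
      measurable_jumpPath i (d k) (measurableSet_singleton (y k))
  · ext ω
    simp

/-- The renewal equation for a joint law of the jump path at times `τ` and `τ + d k`. -/
lemma renewal (hΛ : 0 < Λ) {ι : Type} [Countable ι] (d : ι → ℝ) (hd : ∀ k, 0 ≤ d k) (y : ι → Fin N)
    (i j : Fin N) {τ : ℝ} (hτ : 0 ≤ τ) :
    IntegrableOn (fun a => (pathMeasure Λ ν).real {ω | jumpPath ω (a.2 i) (τ - a.1) = j ∧
        ∀ k, jumpPath ω (a.2 i) (τ - a.1 + d k) = y k}) {a | a.1 ≤ τ} (markMeasure Λ ν) ∧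
    (pathMeasure Λ ν).real {ω | jumpPath ω i τ = j ∧ ∀ k, jumpPath ω i (τ + d k) = y k} =
      (if i = j then Real.exp (-(Λ * τ)) *
        (pathMeasure Λ ν).real {ω | ∀ k, jumpPath ω j (d k) = y k} else 0) +
      ∫ a in {a | a.1 ≤ τ}, (pathMeasure Λ ν).real {ω | jumpPath ω (a.2 i) (τ - a.1) = j ∧
        ∀ k, jumpPath ω (a.2 i) (τ - a.1 + d k) = y k} ∂markMeasure Λ ν := by
  have := isProbabilityMeasure_markMeasure ν hΛ
  have := isProbabilityMeasure_pathMeasure ν hΛ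
  have hne := ae_nonexplosive (ν := ν) hΛ
  set W : Set (ℕ → Mark N) :=
    {ω | jumpPath ω i τ = j ∧ ∀ k, jumpPath ω i (τ + d k) = y k} with hWdef
  have hW : MeasurableSet W := (measurable_jumpPath i τ (measurableSet_singleton j)).inter
    (measurableSet_jumpPath_forall i (fun k => τ + d k) y)
  set A : Set (Mark N) := {a | a.1 ≤ τ} with hA
  have hAm : MeasurableSet A := measurableSet_le measurable_fst measurable_const
  obtain ⟨h1, h2⟩ := pathMeasure_real_eq_integral (ν := ν) hΛ hW
  -- First event by time `τ`: the path restarts from the new state.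
  have hle : Set.EqOn (fun a => (pathMeasure Λ ν).real {ω | consSeq a ω ∈ W})
      (fun a => (pathMeasure Λ ν).real {ω | jumpPath ω (a.2 i) (τ - a.1) = j ∧
        ∀ k, jumpPath ω (a.2 i) (τ - a.1 + d k) = y k}) A := by
    intro a ha
    refine measureReal_congr ?_
    filter_upwards [hne] with ω hω
    refine propext ?_
    change (jumpPath (consSeq a ω) i τ = j ∧ ∀ k, jumpPath (consSeq a ω) i (τ + d k) = y k) ↔
      (jumpPath ω (a.2 i) (τ - a.1) = j ∧ ∀ k, jumpPath ω (a.2 i) (τ - a.1 + d k) = y k)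
    rw [jumpPath_consSeq_of_le hω i ha]
    refine and_congr Iff.rfl (forall_congr' fun k => ?_)
    rw [jumpPath_consSeq_of_le hω i (show a.1 ≤ τ + d k from le_add_of_le_of_nonneg ha (hd k)),
      sub_add_eq_add_sub]
  have hgt : Set.EqOn (fun a => (pathMeasure Λ ν).real {ω | consSeq a ω ∈ W})
      (fun a => if i = j then (fun a => (pathMeasure Λ ν).real {ω | consSeq a ω ∈
        {ω | ∀ k, jumpPath ω j (d k) = y k}}) (a.1 - τ, a.2) else 0) Aᶜ := by
    intro a ha
    have ha' : τ < a.1 := not_le.1 ha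
    by_cases hij : i = j
    · simp only [hij, if_true]
      refine measureReal_congr ?_
      filter_upwards [hne] with ω hω
      refine propext ?_
      change (jumpPath (consSeq a ω) i τ = j ∧ ∀ k, jumpPath (consSeq a ω) i (τ + d k) = y k) ↔
        ∀ k, jumpPath (consSeq (a.1 - τ, a.2) ω) j (d k) = y k
      rw [jumpPath_consSeq_of_lt hω i ha', ← hij]
      simp only [true_and]
      refine forall_congr' fun k => ?_
      rw [← jumpPath_consSeq_add hω i (d k)]
    · simp only [hij, if_false]
      rw [measureReal_congr (t := ∅), measureReal_empty]
      filter_upwards [hne] with ω hω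
      refine propext ⟨fun h => ?_, False.elim⟩
      have h' : jumpPath (consSeq a ω) i τ = j := h.1
      rw [jumpPath_consSeq_of_lt hω i ha'] at h'
      exact hij h'
  refine ⟨h1.integrableOn.congr_fun hle hAm, ?_⟩
  rw [h2, ← integral_add_compl hAm h1, add_comm, setIntegral_congr_fun hAm hle,
    setIntegral_congr_fun hAm.compl hgt]
  congr 1
  split_ifs with hij
  · obtain ⟨h3, h4⟩ := pathMeasure_real_eq_integral (ν := ν) hΛ
      (measurableSet_jumpPath_forall j d y)
    rw [h4, ← setIntegral_markMeasure_gt hΛ hτ _ h3]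
  · simp

/-- Uniqueness for the homogeneous renewal equation. -/
lemma eq_zero_of_renewal (hΛ : 0 < Λ) {D : Fin N → ℝ → ℝ}
    (hbdd : ∀ T, ∃ B, ∀ i, ∀ τ ∈ Set.Icc 0 T, |D i τ| ≤ B)
    (hD : ∀ i τ, 0 ≤ τ → D i τ = ∫ a in {a | a.1 ≤ τ}, D (a.2 i) (τ - a.1) ∂markMeasure Λ ν)
    (i : Fin N) {τ : ℝ} (hτ : 0 ≤ τ) : D i τ = 0 := by
  have := isProbabilityMeasure_markMeasure ν hΛ
  obtain ⟨B, hB⟩ := hbdd τ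
  set θ := (expMeasure Λ).real (Set.Iic τ) with hθ
  have hθ0 : 0 ≤ θ := measureReal_nonneg
  have hθ1 : θ < 1 := expMeasure_real_Iic_lt_one hΛ τ
  have hB0 : 0 ≤ B := (abs_nonneg _).trans (hB i 0 ⟨le_rfl, hτ⟩)
  -- Each use of the equation gains a factor `θ`, the probability that the first event occurs by
  -- `τ`.
  have key : ∀ n : ℕ, ∀ i, ∀ s ∈ Set.Icc 0 τ, |D i s| ≤ B * θ ^ n := by
    intro n
    induction n with
    | zero => simpa using hB
    | succ n ih =>
      intro i s hs
      rw [hD i s hs.1, ← Real.norm_eq_abs]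
      have hms : MeasurableSet {a : Mark N | a.1 ≤ s} :=
        measurableSet_le measurable_fst measurable_const
      have h1 : ‖∫ a in {a | a.1 ≤ s}, D (a.2 i) (s - a.1) ∂markMeasure Λ ν‖ ≤
          B * θ ^ n * (markMeasure Λ ν).real {a | a.1 ≤ s} := by
        refine norm_setIntegral_le_of_norm_le_const_ae' (measure_lt_top _ _) ?_
        filter_upwards [ae_pos_markMeasure hΛ] with a ha has
        exact ih _ _ ⟨sub_nonneg.2 has, by linarith [hs.2]⟩
      refine h1.trans ?_
      rw [markMeasure_real_le hΛ, pow_succ, ← mul_assoc]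
      have := isProbabilityMeasure_expMeasure hΛ
      exact mul_le_mul_of_nonneg_left (measureReal_mono (Set.Iic_subset_Iic.2 hs.2))
        (by positivity)
  have hlim : Tendsto (fun n : ℕ => B * θ ^ n) atTop (𝓝 0) := by
    simpa using (tendsto_pow_atTop_nhds_zero_of_lt_one hθ0 hθ1).const_mul B
  have := ge_of_tendsto' hlim fun n => key n i τ ⟨hτ, le_rfl⟩
  exact abs_eq_zero.1 (le_antisymm this (abs_nonneg _))

/-- The transition function of the jump process. -/
def jumpTransition (Λ : ℝ) (ν : Measure (Fin N → Fin N)) (τ : ℝ) (i j : Fin N) : ℝ :=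
  (pathMeasure Λ ν).real {ω | jumpPath ω i τ = j}

lemma jumpTransition_renewal (hΛ : 0 < Λ) (i j : Fin N) {τ : ℝ} (hτ : 0 ≤ τ) :
    IntegrableOn (fun a => jumpTransition Λ ν (τ - a.1) (a.2 i) j) {a | a.1 ≤ τ}
      (markMeasure Λ ν) ∧
    jumpTransition Λ ν τ i j = (if i = j then Real.exp (-(Λ * τ)) else 0) +
      ∫ a in {a | a.1 ≤ τ}, jumpTransition Λ ν (τ - a.1) (a.2 i) j ∂markMeasure Λ ν := by
  have := isProbabilityMeasure_pathMeasure ν hΛ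
  have h := renewal (ν := ν) hΛ (ι := Empty) (fun k => k.elim) (fun k => k.elim)
    (fun k => k.elim) i j hτ
  simpa [jumpTransition] using h

/-- The Markov property of the jump process. -/
lemma jumpPath_markov (hΛ : 0 < Λ) {ι : Type} [Countable ι] (d : ι → ℝ) (hd : ∀ k, 0 ≤ d k)
    (y : ι → Fin N) (i j : Fin N) {τ : ℝ} (hτ : 0 ≤ τ) :
    (pathMeasure Λ ν).real {ω | jumpPath ω i τ = j ∧ ∀ k, jumpPath ω i (τ + d k) = y k} =
      jumpTransition Λ ν τ i j *
        (pathMeasure Λ ν).real {ω | ∀ k, jumpPath ω j (d k) = y k} := by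
  have := isProbabilityMeasure_pathMeasure ν hΛ
  set c := (pathMeasure Λ ν).real {ω | ∀ k, jumpPath ω j (d k) = y k} with hc
  -- Both sides satisfy the same renewal equation in `(i, τ)`, since `c` depends on neither; their
  -- difference solves the homogeneous one.
  set D : Fin N → ℝ → ℝ := fun i τ =>
    (pathMeasure Λ ν).real {ω | jumpPath ω i τ = j ∧ ∀ k, jumpPath ω i (τ + d k) = y k} -
      jumpTransition Λ ν τ i j * c with hD
  have h1 : ∀ s : Set (ℕ → Mark N), |(pathMeasure Λ ν).real s| ≤ 1 := fun s => by
    rw [abs_of_nonneg measureReal_nonneg]; exact measureReal_le_one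
  refine sub_eq_zero.1 (eq_zero_of_renewal (ν := ν) hΛ (D := D) (fun T => ⟨1 + 1 * 1, ?_⟩) ?_ i hτ)
  · intro i τ _
    refine (abs_sub _ _).trans (add_le_add (h1 _) ?_)
    rw [abs_mul]
    exact mul_le_mul (h1 _) (h1 _) (abs_nonneg _) zero_le_one
  · intro i τ hτ
    obtain ⟨h2, h3⟩ := renewal (ν := ν) hΛ d hd y i j hτ
    obtain ⟨h4, h5⟩ := jumpTransition_renewal (ν := ν) hΛ i j hτ
    simp only [hD]
    rw [integral_sub h2 (h4.mul_const c), h3, h5, integral_mul_const]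
    split_ifs <;> ring

/-- The finite-dimensional Markov property of the jump process. -/
lemma jumpPath_markov_chain (hΛ : 0 < Λ) (n : ℕ) : ∀ (τ : Fin (n + 1) → ℝ)
    (x : Fin (n + 1) → Fin N) (i : Fin N), Monotone τ → 0 ≤ τ 0 → ∀ v, τ (Fin.last n) ≤ v →
      ∀ j : Fin N,
      (pathMeasure Λ ν).real {ω | (∀ k, jumpPath ω i (τ k) = x k) ∧ jumpPath ω i v = j} =
        (pathMeasure Λ ν).real {ω | ∀ k, jumpPath ω i (τ k) = x k} *
          jumpTransition Λ ν (v - τ (Fin.last n)) (x (Fin.last n)) j := by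
  induction n with
  | zero =>
    intro τ x i _ h0 v hv j
    have h := jumpPath_markov (ν := ν) hΛ (ι := Unit) (fun _ => v - τ 0)
      (fun _ => sub_nonneg.2 hv) (fun _ => j) i (x 0) h0
    simpa [jumpTransition] using h
  | succ n ih =>
    intro τ x i hτ h0 v hv j
    have hd : ∀ k : Fin (n + 1), 0 ≤ τ k.succ - τ 0 := fun k =>
      sub_nonneg.2 (hτ (Fin.zero_le _))
    have hd' : 0 ≤ v - τ 0 := sub_nonneg.2 ((hτ (Fin.zero_le _)).trans hv)
    -- Conditioning at `τ 0` reduces both joint laws to chains started from `x 0`; the index `none`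
    -- carries the final time `v`.
    have h1 := jumpPath_markov (ν := ν) hΛ (ι := Option (Fin (n + 1)))
      (fun k => k.elim (v - τ 0) fun k => τ k.succ - τ 0)
      (Option.forall.2 ⟨hd', hd⟩)
      (fun k => k.elim j fun k => x k.succ) i (x 0) h0
    have h2 := jumpPath_markov (ν := ν) hΛ (ι := Fin (n + 1))
      (fun k => τ k.succ - τ 0) hd (fun k => x k.succ) i (x 0) h0
    have h3 := ih (fun k => τ k.succ - τ 0) (fun k => x k.succ) (x 0)
      (fun a b hab => sub_le_sub_right (hτ (Fin.succ_le_succ_iff.2 hab)) _)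
      (sub_nonneg.2 (hτ (Fin.zero_le _))) (v - τ 0) (sub_le_sub_right hv _) j
    simp only [Option.forall, Option.elim, add_sub_cancel] at h1 h2
    simp only [Fin.succ_last, sub_sub_sub_cancel_right] at h3
    have e1 : {ω : ℕ → Mark N | (∀ k, jumpPath ω i (τ k) = x k) ∧ jumpPath ω i v = j} =
        {ω | jumpPath ω i (τ 0) = x 0 ∧ jumpPath ω i v = j ∧
          ∀ k : Fin (n + 1), jumpPath ω i (τ k.succ) = x k.succ} := by
      ext ω
      simp only [Set.mem_ofPred_eq, Fin.forall_fin_succ (n := n + 1)]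
      tauto
    have e2 : {ω : ℕ → Mark N | ∀ k, jumpPath ω i (τ k) = x k} =
        {ω | jumpPath ω i (τ 0) = x 0 ∧
          ∀ k : Fin (n + 1), jumpPath ω i (τ k.succ) = x k.succ} := by
      ext ω
      simp only [Set.mem_ofPred_eq, Fin.forall_fin_succ (n := n + 1)]
    rw [e1, e2, h1, h2, mul_assoc, ← h3]
    congr 2
    ext ω
    simp only [Set.mem_ofPred_eq]
    tauto

end Renewal

/-! ### Identification of the transition function with the matrix exponential -/

section Semigroup

open ProbabilityTheory

-- Witness: `exp (τ Q)`. The forward equation serves `IsTransitionFunction`, the backward one the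
-- renewal equation.
open scoped Matrix.Norms.Operator in
lemma exists_matrix_semigroup (Q : Matrix (Fin N) (Fin N) ℝ) :
    ∃ E : ℝ → Matrix (Fin N) (Fin N) ℝ, E 0 = 1 ∧ ∀ τ i j,
      HasDerivAt (fun τ => E τ i j) ((E τ * Q) i j) τ ∧
      HasDerivAt (fun τ => E τ i j) ((Q * E τ) i j) τ := by
  refine ⟨fun τ => NormedSpace.exp (τ • Q), by simp, fun τ i j => ?_⟩
  have hentry : ∀ (f : ℝ → Matrix (Fin N) (Fin N) ℝ) (f' : Matrix (Fin N) (Fin N) ℝ),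
      HasDerivAt f f' τ → HasDerivAt (fun τ => f τ i j) (f' i j) τ := fun f f' h =>
    (LinearMap.toContinuousLinearMap
      (Matrix.entryLinearMap ℝ ℝ i j)).hasFDerivAt.comp_hasDerivAt τ h
  exact ⟨hentry _ _ (hasDerivAt_exp_smul_const Q τ), hentry _ _ (hasDerivAt_exp_smul_const' Q τ)⟩

lemma expMeasure_restrict_Iic {Λ : ℝ} (τ : ℝ) :
    (expMeasure Λ).restrict (Set.Iic τ) =
      (volume.restrict (Set.Icc 0 τ)).withDensity
        fun e => ENNReal.ofReal (Λ * Real.exp (-(Λ * e))) := by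
  have h : expMeasure Λ = volume.withDensity (exponentialPDF Λ) := rfl
  rw [h]
  ext s hs
  rw [Measure.restrict_apply hs, withDensity_apply _ (hs.inter measurableSet_Iic),
    withDensity_apply _ hs, Measure.restrict_restrict hs, ← lintegral_indicator
      (hs.inter measurableSet_Iic), ← lintegral_indicator (hs.inter measurableSet_Icc)]
  congr 1
  ext e
  by_cases h1 : e ∈ s ∩ Set.Icc 0 τ
  · rw [Set.indicator_of_mem h1, Set.indicator_of_mem (show e ∈ s ∩ Set.Iic τ from ⟨h1.1, h1.2.2⟩),
      exponentialPDF_of_nonneg h1.2.1]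
  · rw [Set.indicator_of_notMem h1]
    by_cases h2 : e ∈ s ∩ Set.Iic τ
    · rw [Set.indicator_of_mem h2, exponentialPDF_of_neg]
      by_contra! h3
      exact h1 ⟨h2.1, h3, h2.2⟩
    · rw [Set.indicator_of_notMem h2]

lemma setIntegral_Iic_expMeasure {Λ : ℝ} (hΛ : 0 < Λ) {τ : ℝ} (hτ : 0 ≤ τ) (h : ℝ → ℝ) :
    ∫ e in Set.Iic τ, h e ∂expMeasure Λ =
      ∫ e in (0)..τ, Λ * Real.exp (-(Λ * e)) * h e := by
  rw [expMeasure_restrict_Iic, integral_withDensity_eq_integral_toReal_smul (by fun_prop)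
    (Eventually.of_forall fun _ => ENNReal.ofReal_lt_top), intervalIntegral.integral_of_le hτ,
    ← integral_Icc_eq_integral_Ioc]
  refine integral_congr_ae (Eventually.of_forall fun e => ?_)
  simp only [smul_eq_mul]
  rw [ENNReal.toReal_ofReal (by positivity)]

lemma integrableOn_Iic_expMeasure {Λ : ℝ} (hΛ : 0 < Λ) {τ : ℝ} {h : ℝ → ℝ}
    (hh : Continuous h) : IntegrableOn h (Set.Iic τ) (expMeasure Λ) := by
  have := isProbabilityMeasure_expMeasure hΛ
  obtain ⟨B, hB⟩ := (isCompact_Icc (a := (0 : ℝ)) (b := τ)).exists_bound_of_continuousOn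
    hh.continuousOn
  refine Integrable.of_bound hh.aestronglyMeasurable B ?_
  have hac : (expMeasure Λ).restrict (Set.Iic τ) ≪ volume.restrict (Set.Icc 0 τ) := by
    rw [expMeasure_restrict_Iic]
    exact withDensity_absolutelyContinuous _ _
  exact hac.ae_le ((ae_restrict_mem measurableSet_Icc).mono hB)

variable {Λ : ℝ} {ν : Measure (Fin N → Fin N)} [IsProbabilityMeasure ν]

/-- The matrix semigroup satisfies the renewal equation of the jump process. -/
lemma semigroup_renewal (hΛ : 0 < Λ) {Q : Matrix (Fin N) (Fin N) ℝ}
    (hν : ∀ i k, Λ * ν.real {f | f i = k} = Λ * (1 : Matrix (Fin N) (Fin N) ℝ) i k + Q i k)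
    {E : ℝ → Matrix (Fin N) (Fin N) ℝ} (hE0 : E 0 = 1)
    (hE : ∀ τ i j, HasDerivAt (fun τ => E τ i j) ((Q * E τ) i j) τ) (i j : Fin N) {τ : ℝ}
    (hτ : 0 ≤ τ) :
    IntegrableOn (fun a => E (τ - a.1) (a.2 i) j) {a | a.1 ≤ τ} (markMeasure Λ ν) ∧
    E τ i j = (if i = j then Real.exp (-(Λ * τ)) else 0) +
      ∫ a in {a | a.1 ≤ τ}, E (τ - a.1) (a.2 i) j ∂markMeasure Λ ν := by
  have := isProbabilityMeasure_expMeasure hΛ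
  have hcont : ∀ i j, Continuous fun τ => E τ i j := fun i j =>
    continuous_iff_continuousAt.2 fun τ => (hE τ i j).continuousAt
  have hset : {a : Mark N | a.1 ≤ τ} = Set.Iic τ ×ˢ Set.univ := by ext; simp
  have hη : (markMeasure Λ ν).restrict {a | a.1 ≤ τ} =
      ((expMeasure Λ).restrict (Set.Iic τ)).prod ν := by
    rw [hset, markMeasure, ← Measure.prod_restrict, Measure.restrict_univ]
  have hint : Integrable (fun a : Mark N => E (τ - a.1) (a.2 i) j)
      (((expMeasure Λ).restrict (Set.Iic τ)).prod ν) := by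
    refine integrable_comp_finite_valued (Y := fun a : Mark N => a.2 i)
      (b := fun a k => E (τ - a.1) k j) ((measurable_pi_apply i).comp measurable_snd) fun k => ?_
    have h := integrableOn_Iic_expMeasure hΛ (τ := τ)
      (h := fun e => E (τ - e) k j) ((hcont k j).comp (by fun_prop))
    exact h.comp_fst ν
  refine ⟨by rw [IntegrableOn, hη]; exact hint, ?_⟩
  rw [hη, integral_prod _ hint]
  have hinner : ∀ e, ∫ f, E (τ - e) (f i) j ∂ν = ∑ k, ν.real {f | f i = k} * E (τ - e) k j :=
    fun e => integral_comp_finite_valued (measurable_pi_apply i) fun k => E (τ - e) k j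
  simp_rw [hinner]
  rw [setIntegral_Iic_expMeasure hΛ hτ]
  -- An antiderivative of the integrand: by `hν`, averaging over the jump turns `Λ E` into `Λ E + Q
  -- E`, which matches the backward equation.
  set G : ℝ → ℝ := fun e => -(Real.exp (-(Λ * e)) * E (τ - e) i j) with hG
  have hder : ∀ e, HasDerivAt G
      (Λ * Real.exp (-(Λ * e)) * ∑ k, ν.real {f | f i = k} * E (τ - e) k j) e := by
    intro e
    have h1 : HasDerivAt (fun e => Real.exp (-(Λ * e))) (Real.exp (-(Λ * e)) * (-Λ)) e := by
      have := (((hasDerivAt_id e).const_mul Λ).neg).exp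
      simpa using this
    have h2 : HasDerivAt (fun e => E (τ - e) i j) (-((Q * E (τ - e)) i j)) e := by
      have := (hE (τ - e) i j).comp e ((hasDerivAt_id e).const_sub τ)
      simpa [Function.comp_def] using this
    have h3 := (h1.mul h2).neg
    refine h3.congr_deriv ?_
    have h4 : Λ * ∑ k, ν.real {f | f i = k} * E (τ - e) k j =
        Λ * E (τ - e) i j + (Q * E (τ - e)) i j := by
      rw [Finset.mul_sum]
      simp_rw [← mul_assoc, hν, add_mul, Finset.sum_add_distrib, Matrix.mul_apply]
      simp [Matrix.one_apply]
    have h5 : Λ * Real.exp (-(Λ * e)) * ∑ k, ν.real {f | f i = k} * E (τ - e) k j =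
        Real.exp (-(Λ * e)) * (Λ * ∑ k, ν.real {f | f i = k} * E (τ - e) k j) := by ring
    rw [h5, h4]
    ring
  have hc : Continuous fun e =>
      Λ * Real.exp (-(Λ * e)) * ∑ k, ν.real {f | f i = k} * E (τ - e) k j := by
    have : ∀ k, Continuous fun e => E (τ - e) k j := fun k => (hcont k j).comp (by fun_prop)
    fun_prop
  rw [intervalIntegral.integral_eq_sub_of_hasDerivAt (fun e _ => hder e)
    (hc.intervalIntegrable _ _)]
  simp only [hG, sub_self, hE0, sub_zero, mul_zero, neg_zero, Real.exp_zero, one_mul,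
    Matrix.one_apply]
  split_ifs <;> ring

/-- The transition function of the jump process is the semigroup of its generator. -/
lemma jumpTransition_eq_semigroup (hΛ : 0 < Λ) {Q : Matrix (Fin N) (Fin N) ℝ}
    (hν : ∀ i k, Λ * ν.real {f | f i = k} = Λ * (1 : Matrix (Fin N) (Fin N) ℝ) i k + Q i k)
    {E : ℝ → Matrix (Fin N) (Fin N) ℝ} (hE0 : E 0 = 1)
    (hE : ∀ τ i j, HasDerivAt (fun τ => E τ i j) ((Q * E τ) i j) τ) (i j : Fin N) {τ : ℝ}
    (hτ : 0 ≤ τ) : jumpTransition Λ ν τ i j = E τ i j := by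
  have := isProbabilityMeasure_pathMeasure ν hΛ
  refine sub_eq_zero.1 (eq_zero_of_renewal (ν := ν) hΛ
    (D := fun i τ => jumpTransition Λ ν τ i j - E τ i j) (fun T => ?_) ?_ i hτ)
  · have hc : ∀ i, ∃ B, ∀ τ ∈ Set.Icc 0 T, ‖E τ i j‖ ≤ B := fun i =>
      isCompact_Icc.exists_bound_of_continuousOn
        (continuous_iff_continuousAt.2 fun τ => (hE τ i j).continuousAt).continuousOn
    choose B hB using hc
    refine ⟨1 + ∑ i, |B i|, fun i τ hτ => (abs_sub _ _).trans (add_le_add ?_ ?_)⟩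
    · rw [jumpTransition, abs_of_nonneg measureReal_nonneg]
      exact measureReal_le_one
    · exact ((hB i τ hτ).trans (le_abs_self _)).trans
        (Finset.single_le_sum (f := fun i => |B i|) (fun _ _ => abs_nonneg _) (Finset.mem_univ i))
  · intro i τ hτ
    obtain ⟨h1, h2⟩ := jumpTransition_renewal (ν := ν) hΛ i j hτ
    obtain ⟨h3, h4⟩ := semigroup_renewal (ν := ν) hΛ hν hE0 hE i j hτ
    rw [integral_sub h1 h3]
    linarith

end Semigroup

/-! ### Existence of chains with constant rates -/

section Existence

/-- A product law on maps with prescribed marginals. -/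
lemma exists_measure_maps (R : Fin N → Fin N → ℝ) (h0 : ∀ i k, 0 ≤ R i k)
    (h1 : ∀ i, ∑ k, R i k = 1) :
    ∃ ν : Measure (Fin N → Fin N), IsProbabilityMeasure ν ∧
      ∀ i k, ν.real {f | f i = k} = R i k := by
  set ρ : Fin N → Measure (Fin N) := fun i =>
    ∑ k, ENNReal.ofReal (R i k) • Measure.dirac k with hρ
  have hρk : ∀ i k, ρ i {k} = ENNReal.ofReal (R i k) := by
    intro i k
    simp only [hρ, Measure.coe_finsetSum, Finset.sum_apply, Measure.smul_apply, smul_eq_mul,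
      Measure.dirac_apply' _ (measurableSet_singleton k)]
    rw [Finset.sum_eq_single k]
    · simp
    · intro m _ hm
      simp [hm]
    · simp
  have hρp : ∀ i, IsProbabilityMeasure (ρ i) := fun i => ⟨by
    simp only [hρ, Measure.coe_finsetSum, Finset.sum_apply, Measure.smul_apply, smul_eq_mul,
      measure_univ, mul_one]
    rw [← ENNReal.ofReal_sum_of_nonneg fun k _ => h0 i k, h1, ENNReal.ofReal_one]⟩
  -- Only the marginals matter; independence across states is one convenient coupling.
  refine ⟨Measure.pi ρ, inferInstance, fun i k => ?_⟩
  have h := (measurePreserving_eval ρ i).measure_preimage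
    (measurableSet_singleton k).nullMeasurableSet
  rw [measureReal_def]
  change (Measure.pi ρ (Function.eval i ⁻¹' {k})).toReal = _
  rw [h, hρk, ENNReal.toReal_ofReal (h0 i k)]

variable {V : Fin N → Finset (Fin N)}

/-- Chains with constant rates exist. -/
theorem exists_isMarkovChain_const (hV : ∀ i, i ∉ V i) (m : Intensities V) (t : ℝ) (i : Fin N) :
    ∃ (Ω : Type) (_ : MeasurableSpace Ω) (P : Measure Ω) (_ : IsProbabilityMeasure P)
      (X : ℝ → Ω → Fin N), IsMarkovChain P (Set.Ici t) t i (fun _ => m) X := by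
  set Q := generator m with hQ
  -- The uniformization rate is positive and at least every total exit rate, so `1 + Q / Λ` is a
  -- stochastic matrix.
  set Λ : ℝ := 1 + ∑ i, ∑ k : V i, (m i k : ℝ) with hΛdef
  have hsum0 : ∀ i, 0 ≤ ∑ k : V i, (m i k : ℝ) := fun i =>
    Finset.sum_nonneg fun _ _ => NNReal.coe_nonneg _
  have hΛ : 0 < Λ := add_pos_of_pos_of_nonneg one_pos (Finset.sum_nonneg fun i _ => hsum0 i)
  have hΛi : ∀ i, ∑ k : V i, (m i k : ℝ) ≤ Λ := fun i => by
    have := Finset.single_le_sum (f := fun i => ∑ k : V i, (m i k : ℝ)) (fun i _ => hsum0 i)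
      (Finset.mem_univ i)
    linarith
  have hR0 : ∀ i k, 0 ≤ (1 : Matrix (Fin N) (Fin N) ℝ) i k + Q i k / Λ := by
    intro i k
    rcases eq_or_ne i k with rfl | hik
    · have : Q i i = -∑ k : V i, (m i k : ℝ) := by simp [hQ, generator, hV i]
      rw [this, Matrix.one_apply_eq, neg_div]
      have := (div_le_one hΛ).2 (hΛi i)
      linarith
    · rw [Matrix.one_apply_ne hik, zero_add]
      refine div_nonneg ?_ hΛ.le
      simp only [hQ, generator, if_neg hik, sub_zero]
      split_ifs
      exacts [NNReal.coe_nonneg _, le_rfl]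
  have hR1 : ∀ i, ∑ k, ((1 : Matrix (Fin N) (Fin N) ℝ) i k + Q i k / Λ) = 1 := by
    intro i
    have h := generator_mulVec m (fun _ => 1) i
    simp only [mul_one, sub_self, mul_zero, Finset.sum_const_zero] at h
    rw [Finset.sum_add_distrib, ← Finset.sum_div, h]
    simp [Matrix.one_apply]
  obtain ⟨ν, hνp, hν⟩ := exists_measure_maps
    (fun i k => (1 : Matrix (Fin N) (Fin N) ℝ) i k + Q i k / Λ) hR0 hR1
  have hν' : ∀ i k, Λ * ν.real {f | f i = k} =
      Λ * (1 : Matrix (Fin N) (Fin N) ℝ) i k + Q i k := fun i k => by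
    rw [hν, mul_add, mul_div_cancel₀ _ hΛ.ne']
  obtain ⟨E, hE0, hE⟩ := exists_matrix_semigroup Q
  have hp : ∀ i j, ∀ τ, 0 ≤ τ → jumpTransition Λ ν τ i j = E τ i j := fun i j τ hτ =>
    jumpTransition_eq_semigroup hΛ hν' hE0 (fun τ i j => (hE τ i j).2) i j hτ
  have hcont : ∀ i j, Continuous fun τ => E τ i j := fun i j =>
    continuous_iff_continuousAt.2 fun τ => (hE τ i j).1.continuousAt
  refine ⟨ℕ → Mark N, inferInstance, pathMeasure Λ ν, isProbabilityMeasure_pathMeasure ν hΛ,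
    fun s ω => jumpPath ω i (s - t), ?_⟩
  refine ⟨fun s _ => measurable_jumpPath i (s - t), fun ω s _ => ?_, fun ω s _ => ?_, ?_, ?_⟩
  · refine ((continuousWithinAt_jumpPath ω i (s - t)).comp
      (f := fun v : ℝ => v - t) (s := Set.Ici s) (by fun_prop)
      (fun v hv => sub_le_sub_right hv t)).mono Set.inter_subset_right
  · obtain ⟨j, hj⟩ := exists_tendsto_jumpPath ω i (s - t)
    refine ⟨j, hj.comp (tendsto_nhdsWithin_iff.2 ⟨?_, ?_⟩)⟩
    · exact (continuous_id.sub continuous_const).continuousWithinAt.tendsto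
    · filter_upwards [self_mem_nhdsWithin] with v hv
      exact sub_lt_sub_right hv.2 t
  · filter_upwards [ae_jumpPath_zero hΛ i] with ω hω
    rw [sub_self, hω]
  -- Constant rates make the transition function depend on `v - s` only.
  · refine ⟨fun s v => E (v - s), ?_, ?_⟩
    · intro s _ i j
      have hc : ∀ i j, Continuous fun v => E (v - s) i j := fun i j =>
        (hcont i j).comp (by fun_prop)
      refine ⟨(hc i j).continuousOn, fun v _ _ => ?_⟩
      have hder : ∀ v, HasDerivAt (fun v => E (v - s) i j) ((E (v - s) * Q) i j) v := fun v => by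
        have := (hE (v - s) i j).1.comp v ((hasDerivAt_id v).sub_const s)
        simpa [Function.comp_def] using this
      have hcd : Continuous fun v => (E (v - s) * Q) i j := by
        simp only [Matrix.mul_apply]
        have := hc i
        fun_prop
      rw [intervalIntegral.integral_eq_sub_of_hasDerivAt (fun v _ => hder v)
        (hcd.intervalIntegrable _ _), sub_self, hE0]
      ring
    · intro n τ x hτ hτS v hv hlast j
      have h := jumpPath_markov_chain (ν := ν) hΛ n (fun k => τ k - t) x i
        (fun a b hab => sub_le_sub_right (hτ hab) t) (sub_nonneg.2 (hτS 0)) (v - t)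
        (sub_le_sub_right hlast t) j
      rw [h, sub_sub_sub_cancel_right, hp _ _ _ (sub_nonneg.2 hlast)]

end Existence

end GraphControl

end

/-! ### The main theorem -/

theorem mainTheorem6 (N : ℕ) (V : Fin N → Finset (Fin N)) (hV : ∀ i, i ∉ V i)
    (hconn : GraphControl.Connected V)
    (L : (i : Fin N) → (V i → ℝ≥0) → EReal) (hL : GraphControl.CostAssumptions V L)
    (g : Fin N → ℝ) (r : ℝ) (hr : 0 < r) :
    ∃ u : Fin N → ℝ,
      (∀ i, GraphControl.valueInf L r i = (u i : EReal)) ∧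
      (∀ i (t : ℝ), 0 ≤ t →
        Tendsto (fun T : ℝ => GraphControl.value L g r T i t) atTop (𝓝 (u i : EReal))) ∧
      (∀ i, ((-(r * u i) : ℝ) : EReal) +
        GraphControl.hamiltonian L i (fun j => u j - u i) = 0) := by
  open GraphControl in
  obtain ⟨u, hu, hatt⟩ := exists_bellman_solution hL hr
  choose m hm using hatt
  have hopt : IsOptimal L r u m := hm
  obtain ⟨C, hC⟩ := hL.bounded_below
  have hadmInf : (fun _ => m) ∈ admissibleInf V 0 := fun i j =>
    (continuous_const.locallyIntegrable).locallyIntegrableOn _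
  have hadm : ∀ t T, (fun _ => m) ∈ admissible V t T := fun t T i j =>
    continuousOn_const.integrableOn_Icc
  refine ⟨u, fun i => le_antisymm (sSup_le ?_) ?_, fun i t _ => ?_, fun i => ?_⟩
  · rintro _ ⟨l, hl, Ω, _, P, _, X, hX, rfl⟩
    exact payoffInf_le hr hu hC hl hX
  · obtain ⟨Ω, _, P, _, X, hX⟩ := exists_isMarkovChain_const hV m 0 i
    exact (le_payoffInf hr hopt hadmInf hX).trans
      (le_sSup ⟨fun _ => m, hadmInf, Ω, _, P, inferInstance, X, hX, rfl⟩)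
  · set M : ℝ := ∑ k, |g k - u k| with hMdef
    have hM : ∀ k, |g k - u k| ≤ M := fun k =>
      Finset.single_le_sum (f := fun k => |g k - u k|) (fun _ _ => abs_nonneg _)
        (Finset.mem_univ k)
    -- The value lies within `e^{-r(T-t)} M` of `u i`: every control obeys the upper bound, the
    -- feedback `m` gives the lower one.
    refine tendsto_of_tendsto_of_tendsto_of_le_of_le'
      (tendsto_coe_add_exp_mul hr (u i) t (-M)) (tendsto_coe_add_exp_mul hr (u i) t M) ?_ ?_
    · filter_upwards [eventually_ge_atTop t] with T hT
      obtain ⟨Ω, _, P, _, X, hX⟩ := exists_isMarkovChain_const hV m t i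
      have hXT := hX.mono (S' := Set.Icc t T) Set.Icc_subset_Ici_self
      have h := le_payoff hopt hT (hadm t T) hXT hM
      rw [mul_neg, ← sub_eq_add_neg]
      exact h.trans (le_sSup ⟨fun _ => m, hadm t T, Ω, _, P, inferInstance, X, hXT, rfl⟩)
    · filter_upwards [eventually_ge_atTop t] with T hT
      refine sSup_le ?_
      rintro _ ⟨l, hl, Ω, _, P, _, X, hX, rfl⟩
      exact payoff_le hu hT hl hX hM
  · rw [hamiltonian_eq_of_attained hu (hm i), ← EReal.coe_add, neg_add_cancel, EReal.coe_zero]
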